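/- Let $(M,g)$ be a globally hyperbolic space-time: $M$ is a connected (Hausdorff, second countable) smooth manifold, $g$ is a smooth Lorentzian metric of signature $(-,+,\dots,+)$, time-oriented by a continuous timelike vector field $X$, there are no closed causal curves, and $J^+(p)\cap J^-(q)$ is compact for all $p,q\in M$. A vector $V\in T_xM$ is timelike if $g(V,V)<0$ and causal if $V\neq 0$ and $g(V,V)\le 0$; a causal vector $V$ is future-directed if $g(X(x),V)<0$ and past-directed if $g(X(x),V)>0$. Write $x\ll y$ if there is a future-directed timelike piecewise $C^1$ curve from $x$ to $y$, and $x\le y$ if $x=y$ or there is a future-directed causal piecewise $C^1$ curve from $x$ to $y$; $J^{+}(x)=\{y: x\le y\}$, $J^-(x)=\{y:y\le x\}$. For $x\le y$ let $$d(x,y)=\sup_\gamma\int\sqrt{-g(\dot\gamma,\dot\gamma)}\,dt,$$ the supremum being over all future-directed causal (or constant) curves $\gamma$ from $x$ to $y$. Let $\Gamma\subset M$ be a Cauchy surface, i.e. a set that every inextendible future-directed causal curve meets exactly once, let $I^-[\Gamma]=\{x\in M: x\ll y\text{ for some }y\in\Gamma\}$, let $\phi:\Gamma\to\mathbb R$ be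 locally Lipschitz (with respect to a Riemannian metric $h$ on $M$), and put $$u_\phi(x)=\inf\{\phi(y)-d(x,y): y\in\Gamma,\ x\le y\},\qquad x\in I^-[\Gamma].$$ If $u_\phi$ is differentiable at $x\in I^-[\Gamma]$, then its Lorentzian gradient $\nabla u_\phi(x)\in T_xM$, defined by $g(\nabla u_\phi(x),W)=du_\phi(x)(W)$ for all $W\in T_xM$, is a past-directed timelike vector, and $$g(\nabla u_\phi(x),\nabla u_\phi(x))=-1.$$ -/

import Mathlib

open Set Filter Topology Bundle
open scoped Manifold ContDiff ENNReal NNReal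

noncomputable section

/-- A smooth Lorentzian metric of signature `(-, +, …, +)` on an `(n+1)`-dimensional
smooth manifold. -/
structure LorentzianMetric (n : ℕ) (M : Type*) [TopologicalSpace M]
    [ChartedSpace (EuclideanSpace ℝ (Fin (n + 1))) M] [IsManifold (𝓡 (n + 1)) ∞ M] where
  /-- the bilinear form on each tangent space -/
  val : ∀ x : M, TangentSpace (𝓡 (n + 1)) x →L[ℝ] TangentSpace (𝓡 (n + 1)) x →L[ℝ] ℝ
  symm : ∀ (x : M) (v w : TangentSpace (𝓡 (n + 1)) x), val x v w = val x w v
  /-- signature `(-, +, …, +)`: every tangent space has an orthonormal basis `e₀, …, eₙ` with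
  `g(e₀, e₀) = -1` and `g(eᵢ, eᵢ) = 1` for `i ≥ 1` -/
  signature : ∀ x : M, ∃ e : Module.Basis (Fin (n + 1)) ℝ (TangentSpace (𝓡 (n + 1)) x),
    ∀ i j, val x (e i) (e j) = if i = j then (if i = 0 then -1 else 1) else 0
  smooth : ContMDiff (𝓡 (n + 1))
    ((𝓡 (n + 1)).prod
      𝓘(ℝ, EuclideanSpace ℝ (Fin (n + 1)) →L[ℝ] EuclideanSpace ℝ (Fin (n + 1)) →L[ℝ] ℝ)) ∞
    (fun x ↦ TotalSpace.mk'
      (EuclideanSpace ℝ (Fin (n + 1)) →L[ℝ] EuclideanSpace ℝ (Fin (n + 1)) →L[ℝ] ℝ) x (val x))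

/-- A Lorentzian metric together with a time orientation, given by a continuous timelike
vector field `X`. (Connectedness of `M` is assumed separately.) -/
structure SpaceTime (n : ℕ) (M : Type*) [TopologicalSpace M]
    [ChartedSpace (EuclideanSpace ℝ (Fin (n + 1))) M] [IsManifold (𝓡 (n + 1)) ∞ M]
    extends LorentzianMetric n M where
  /-- the time-orienting vector field -/
  X : ∀ x : M, TangentSpace (𝓡 (n + 1)) x
  X_continuous : Continuous (fun x ↦ (⟨x, X x⟩ : TangentBundle (𝓡 (n + 1)) M))
  X_timelike : ∀ x : M, val x (X x) (X x) < 0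

section Gradient

variable {n : ℕ} {M : Type*} [TopologicalSpace M]
  [ChartedSpace (EuclideanSpace ℝ (Fin (n + 1))) M] [IsManifold (𝓡 (n + 1)) ∞ M]

/-- `v ↦ g(v, ·)` as a linear map from the tangent space to its dual. -/
def LorentzianMetric.flat (g : LorentzianMetric n M) (x : M) :
    TangentSpace (𝓡 (n + 1)) x →ₗ[ℝ] Module.Dual ℝ (TangentSpace (𝓡 (n + 1)) x) where
  toFun v := (g.val x v).toLinearMap
  map_add' v w := by ext z; simp
  map_smul' c v := by ext z; simp

theorem LorentzianMetric.flat_injective (g : LorentzianMetric n M) (x : M) :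
    Function.Injective (g.flat x) := by
  obtain ⟨e, he⟩ := g.signature x
  rw [← LinearMap.ker_eq_bot, LinearMap.ker_eq_bot']
  intro v hv
  refine e.ext_elem fun j ↦ ?_
  have h1 : g.val x (e j) v = 0 := by
    rw [g.symm]
    exact LinearMap.congr_fun hv (e j)
  rw [← e.sum_repr v, map_sum] at h1
  simp only [map_smul, he, smul_eq_mul, mul_ite, mul_zero, Finset.sum_ite_eq,
    Finset.mem_univ, if_true] at h1
  have h2 : e.repr v j = 0 := by
    split_ifs at h1 <;> linarith
  simp [h2]

theorem LorentzianMetric.flat_bijective (g : LorentzianMetric n M) (x : M) :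
    Function.Bijective (g.flat x) := by
  obtain ⟨e, -⟩ := g.signature x
  have : Module.Finite ℝ (TangentSpace (𝓡 (n + 1)) x) := Module.Finite.of_basis e
  refine ⟨g.flat_injective x, ?_⟩
  exact (LinearMap.injective_iff_surjective_of_finrank_eq_finrank
    (Subspace.dual_finrank_eq (K := ℝ) (V := TangentSpace (𝓡 (n + 1)) x)).symm).1
    (g.flat_injective x)

/-- The Lorentzian gradient `∇f(x)`: the vector with `g(∇f(x), w) = df(x)(w)` for all `w`. -/
def LorentzianMetric.grad (g : LorentzianMetric n M) (f : M → ℝ) (x : M) :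
    TangentSpace (𝓡 (n + 1)) x :=
  (LinearEquiv.ofBijective (g.flat x) (g.flat_bijective x)).symm
    (mfderiv (𝓡 (n + 1)) 𝓘(ℝ, ℝ) f x).toLinearMap

theorem LorentzianMetric.val_grad (g : LorentzianMetric n M) (f : M → ℝ) (x : M)
    (w : TangentSpace (𝓡 (n + 1)) x) :
    g.val x (g.grad f x) w = mfderiv (𝓡 (n + 1)) 𝓘(ℝ, ℝ) f x w :=
  LinearMap.congr_fun ((LinearEquiv.ofBijective (g.flat x) (g.flat_bijective x)).apply_symm_apply
    (mfderiv (𝓡 (n + 1)) 𝓘(ℝ, ℝ) f x).toLinearMap) w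

end Gradient

namespace SpaceTime

variable {n : ℕ} {M : Type*} [TopologicalSpace M]
  [ChartedSpace (EuclideanSpace ℝ (Fin (n + 1))) M] [IsManifold (𝓡 (n + 1)) ∞ M]

/-- Timelike vectors: `g(V, V) < 0`. -/
def IsTimelike (S : SpaceTime n M) {x : M} (V : TangentSpace (𝓡 (n + 1)) x) : Prop :=
  S.val x V V < 0

/-- Causal vectors: timelike or lightlike, i.e. nonzero with `g(V, V) ≤ 0`. -/
def IsCausal (S : SpaceTime n M) {x : M} (V : TangentSpace (𝓡 (n + 1)) x) : Prop :=
  V ≠ 0 ∧ S.val x V V ≤ 0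

/-- Future-directed causal vectors. -/
def IsFutureDirected (S : SpaceTime n M) {x : M} (V : TangentSpace (𝓡 (n + 1)) x) : Prop :=
  S.IsCausal V ∧ S.val x (S.X x) V < 0

/-- Past-directed causal vectors. -/
def IsPastDirected (S : SpaceTime n M) {x : M} (V : TangentSpace (𝓡 (n + 1)) x) : Prop :=
  S.IsCausal V ∧ 0 < S.val x (S.X x) V

/-- `γ : [a, b] → M` is a piecewise `C¹` curve all of whose tangent vectors (one-sided ones at
the finitely many break points and at the end points) satisfy `P`. The values of `γ` outside
`[a, b]` are irrelevant. -/
def IsPiecewiseC1With (P : ∀ x : M, TangentSpace (𝓡 (n + 1)) x → Prop)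
    (γ : ℝ → M) (a b : ℝ) : Prop :=
  a < b ∧ ContinuousOn γ (Icc a b) ∧ ∃ B : Finset ℝ, ∀ c d : ℝ, a ≤ c → c < d → d ≤ b →
    (∀ t ∈ B, t ∉ Ioo c d) →
      ContMDiffOn 𝓘(ℝ, ℝ) (𝓡 (n + 1)) 1 γ (Icc c d) ∧
      ∀ t ∈ Icc c d, P (γ t) (mfderivWithin 𝓘(ℝ, ℝ) (𝓡 (n + 1)) γ (Icc c d) t (1 : ℝ))

/-- Future-directed causal (piecewise `C¹`) curves on `[a, b]`. -/
def IsCausalCurve (S : SpaceTime n M) (γ : ℝ → M) (a b : ℝ) : Prop :=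
  IsPiecewiseC1With (fun _ V ↦ S.IsFutureDirected V) γ a b

/-- Future-directed timelike (piecewise `C¹`) curves on `[a, b]`. -/
def IsTimelikeCurve (S : SpaceTime n M) (γ : ℝ → M) (a b : ℝ) : Prop :=
  IsPiecewiseC1With (fun _ V ↦ S.IsTimelike V ∧ S.IsFutureDirected V) γ a b

/-- `p ≪ q`. -/
def Chron (S : SpaceTime n M) (p q : M) : Prop :=
  ∃ (γ : ℝ → M) (a b : ℝ), S.IsTimelikeCurve γ a b ∧ γ a = p ∧ γ b = q

/-- `p ≤ q`: joined by a constant curve or by a future-directed causal curve. -/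
def Caus (S : SpaceTime n M) (p q : M) : Prop :=
  p = q ∨ ∃ (γ : ℝ → M) (a b : ℝ), S.IsCausalCurve γ a b ∧ γ a = p ∧ γ b = q

/-- `I⁻[A]`. -/
def chronPast (S : SpaceTime n M) (A : Set M) : Set M := {p | ∃ s ∈ A, S.Chron p s}

/-- `J⁺(p)`. -/
def causalFuture (S : SpaceTime n M) (p : M) : Set M := {q | S.Caus p q}

/-- `J⁻(p)`. -/
def causalPast (S : SpaceTime n M) (p : M) : Set M := {q | S.Caus q p}

/-- Globally hyperbolic: no causal loops, and all `J⁺(p) ∩ J⁻(q)` are compact. -/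
def IsGloballyHyperbolic (S : SpaceTime n M) : Prop :=
  (∀ (γ : ℝ → M) (a b : ℝ), S.IsCausalCurve γ a b → γ a ≠ γ b) ∧
    ∀ p q : M, IsCompact (S.causalFuture p ∩ S.causalPast q)

/-- Future-directed inextendible causal curves: no past and no future end point. Such a curve
lives on an open interval, which is reparametrized as `ℝ`. -/
def IsInextendibleCausalCurve (S : SpaceTime n M) (γ : ℝ → M) : Prop :=
  (∀ a b : ℝ, a < b → S.IsCausalCurve γ a b) ∧
    (¬ ∃ p : M, Tendsto γ atTop (𝓝 p)) ∧ ¬ ∃ p : M, Tendsto γ atBot (𝓝 p)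

/-- Cauchy surface: every inextendible causal curve meets it exactly once. -/
def IsCauchySurface (S : SpaceTime n M) (Γ : Set M) : Prop :=
  ∀ γ : ℝ → M, S.IsInextendibleCausalCurve γ → ∃! t : ℝ, γ t ∈ Γ

/-- Lorentzian length `∫ √(-g(γ', γ'))` of a piecewise `C¹` causal curve on `[a, b]`. -/
def length (S : SpaceTime n M) (γ : ℝ → M) (a b : ℝ) : ℝ :=
  ∫ t in a..b, Real.sqrt (-S.val (γ t)
    (mfderiv 𝓘(ℝ, ℝ) (𝓡 (n + 1)) γ t (1 : ℝ)) (mfderiv 𝓘(ℝ, ℝ) (𝓡 (n + 1)) γ t (1 : ℝ)))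

/-- Lorentzian distance, for `x ≤ y`: the supremum of the lengths of the future-directed causal
curves from `x` to `y`, and of the constant curve (of length `0`) if `x = y`. Lengths do not
depend on the parametrization, so arbitrary compact parameter intervals are allowed. -/
def dist (S : SpaceTime n M) (x y : M) : ℝ :=
  sSup {l : ℝ | (x = y ∧ l = 0) ∨
    ∃ (γ : ℝ → M) (a b : ℝ), S.IsCausalCurve γ a b ∧ γ a = x ∧ γ b = y ∧ l = S.length γ a b}

/-- `u_φ(x) = inf {φ(y) - d(x, y) : y ∈ Γ, x ≤ y}`. -/
def uSol (S : SpaceTime n M) (Γ : Set M) (φ : Γ → ℝ) (x : M) : ℝ :=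
  sInf {r : ℝ | ∃ y : Γ, (y : M) ∈ S.causalFuture x ∧ r = φ y - S.dist x y}

end SpaceTime

/-- The distance `d_h` of a Riemannian metric `h`: the infimum of the `h`-lengths of paths. -/
def riemDist {n : ℕ} {M : Type*} [TopologicalSpace M]
    [ChartedSpace (EuclideanSpace ℝ (Fin (n + 1))) M] [IsManifold (𝓡 (n + 1)) ∞ M]
    (h : ContMDiffRiemannianMetric (𝓡 (n + 1)) ∞ (EuclideanSpace ℝ (Fin (n + 1)))
      (fun x : M ↦ TangentSpace (𝓡 (n + 1)) x)) (x y : M) : ℝ≥0∞ :=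
  letI : RiemannianBundle (fun x : M ↦ TangentSpace (𝓡 (n + 1)) x) := ⟨h.toRiemannianMetric⟩
  Manifold.riemannianEDist (𝓡 (n + 1)) x y

/-- `φ ∈ Lip_loc(Γ)` with respect to the Riemannian metric `h`. -/
def IsLocLipschitz {n : ℕ} {M : Type*} [TopologicalSpace M]
    [ChartedSpace (EuclideanSpace ℝ (Fin (n + 1))) M] [IsManifold (𝓡 (n + 1)) ∞ M]
    (h : ContMDiffRiemannianMetric (𝓡 (n + 1)) ∞ (EuclideanSpace ℝ (Fin (n + 1)))
      (fun x : M ↦ TangentSpace (𝓡 (n + 1)) x)) (Γ : Set M) (φ : Γ → ℝ) : Prop :=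
  ∀ y : Γ, ∃ U ∈ 𝓝 (y : M), ∃ K : ℝ≥0, ∀ z w : Γ, (z : M) ∈ U → (w : M) ∈ U →
    ENNReal.ofReal |φ z - φ w| ≤ K * riemDist h (z : M) (w : M)

end

/-!
Prolonging nearly optimal curves backwards along a future timelike vector `V` shows that
`du_φ(V) ≥ √(-g(V, V))` for all such `V`. This forces `∇u_φ` to be past timelike with
`g(∇u_φ, ∇u_φ) ≤ -1`. If this inequality were strict, the reverse Cauchy–Schwarz inequality would
give `du_φ(V) ≥ √(-g(V, V)) + δ |V|` for all future causal `V`. Then `u_φ` would grow along short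
causal curves from `x` by more than their length, while along nearly optimal curves it grows by
hardly more than their length.

All this needs `u_φ` to be finite. A point near which length minus final cost is unbounded has a
causal successor, outside a given neighbourhood, with the same property, and so on along an
inextendible causal curve. This curve crosses `Γ`, but a point strictly beyond `Γ` is not a limit of
starting points of causal curves to `Γ`.
-/

/-! ### Lorentzian bilinear forms -/

section LorentzForm

variable {V : Type*} [AddCommGroup V] [Module ℝ V] {B : LinearMap.BilinForm ℝ V}

/-- A symmetric bilinear form of Lorentzian type, with at most one negative direction: it is
positive definite on the orthogonal complement of each vector on which it is negative. -/
structure IsLorentzForm (B : LinearMap.BilinForm ℝ V) : Prop extends B.IsSymm where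
  pos_of_orthogonal : ∀ T v, B T T < 0 → B T v = 0 → v ≠ 0 → 0 < B v v

theorem apply_self_eq_sum_sq_of_repr_eq_zero {ι : Type*} [Fintype ι] [DecidableEq ι]
    (e : Module.Basis ι ℝ V) {i₀ : ι}
    (he : ∀ i j, B (e i) (e j) = if i = j then (if i = i₀ then -1 else 1) else 0) {v : V}
    (hv : e.repr v i₀ = 0) : B v v = ∑ i, e.repr v i ^ 2 := by
  rw [← LinearMap.BilinForm.sum_repr_mul_repr_mul e, Finsupp.sum_fintype _ _ (by simp)]
  refine Finset.sum_congr rfl fun i _ ↦ ?_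
  have hoff : ∀ j ∈ Finset.univ, j ≠ i →
      e.repr v i • e.repr v j • B (e i) (e j) = 0 := by
    intro j _ hji
    simp [he, hji.symm]
  rw [Finsupp.sum_fintype _ _ (by simp), Finset.sum_eq_single i hoff (by simp)]
  rcases eq_or_ne i i₀ with rfl | hi
  · simp [hv]
  · simp [he, hi, sq]

theorem IsLorentzForm.of_basis {ι : Type*} [Finite ι] [DecidableEq ι] (e : Module.Basis ι ℝ V)
    (i₀ : ι) (he : ∀ i j, B (e i) (e j) = if i = j then (if i = i₀ then -1 else 1) else 0) :
    IsLorentzForm B := by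
  have := Fintype.ofFinite ι
  have hsymm : B.IsSymm := (LinearMap.BilinForm.isSymm_iff_basis e).2 fun i j ↦ by
    rw [he, he]; grind
  have hspace {v : V} (hv : e.repr v i₀ = 0) : 0 ≤ B v v := by
    rw [apply_self_eq_sum_sq_of_repr_eq_zero e he hv]
    positivity
  refine ⟨hsymm, fun T v hT hTv hv ↦ ?_⟩
  set a := e.repr T i₀
  set b := e.repr v i₀ with hb
  -- Some combination of `T` and `v` is spacelike, and `B` is diagonal on the span of `T` and `v`.
  have hcomb : 0 ≤ b ^ 2 * B T T + a ^ 2 * B v v := by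
    have hvT : B v T = 0 := by rw [hsymm.eq v T, hTv]
    have h := hspace (v := b • T - a • v) (by simp [a, b, mul_comm])
    simp only [map_sub, map_smul, LinearMap.sub_apply, LinearMap.smul_apply, smul_eq_mul, hTv,
      hvT] at h
    linarith
  rcases eq_or_ne b 0 with hb0 | hb0
  · rw [apply_self_eq_sum_sq_of_repr_eq_zero e he (hb ▸ hb0)]
    obtain ⟨i, hi⟩ := Finsupp.ne_iff.1 ((LinearEquiv.map_ne_zero_iff e.repr).2 hv)
    exact Finset.sum_pos' (fun j _ ↦ sq_nonneg _) ⟨i, Finset.mem_univ i, sq_pos_of_ne_zero hi⟩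
  · have hbT : b ^ 2 * B T T < 0 := mul_neg_of_pos_of_neg (by positivity) hT
    exact pos_of_mul_pos_right (by linarith) (sq_nonneg a)

theorem IsLorentzForm.apply_self_nonneg_of_orthogonal (hB : IsLorentzForm B) {T v : V}
    (hT : B T T < 0) (h : B T v = 0) : 0 ≤ B v v := by
  rcases eq_or_ne v 0 with rfl | hv
  · simp
  · exact (hB.pos_of_orthogonal T v hT h hv).le

theorem IsLorentzForm.apply_self_mul_apply_self_le_sq (hB : IsLorentzForm B) {T : V}
    (hT : B T T < 0) (v : V) : B T T * B v v ≤ B T v ^ 2 := by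
  have horth : 0 ≤ B (B T T • v - B T v • T) (B T T • v - B T v • T) :=
    hB.apply_self_nonneg_of_orthogonal hT (by simp [mul_comm])
  have hexpand : B (B T T • v - B T v • T) (B T T • v - B T v • T) =
      B T T * (B T T * B v v - B T v ^ 2) := by
    simp only [map_sub, map_smul, LinearMap.sub_apply, LinearMap.smul_apply, smul_eq_mul,
      hB.eq v T]
    ring
  rw [hexpand] at horth
  linarith [nonpos_of_mul_nonneg_right horth hT]

theorem IsLorentzForm.apply_neg_of_causal (hB : IsLorentzForm B) {X N v : V} (hX : B X X < 0)
    (hN : B N N < 0) (hXN : B X N < 0) (hv : v ≠ 0) (hvv : B v v ≤ 0) (hXv : B X v ≤ 0) :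
    B N v < 0 := by
  have hXv' : B X v < 0 :=
    hXv.lt_of_ne fun h ↦ (hB.pos_of_orthogonal X v hX h hv).not_ge hvv
  by_contra! hNv
  -- Otherwise a timelike combination of `N` and `X` is orthogonal to `v`.
  set l := B N v / (-B X v)
  have hl : 0 ≤ l := div_nonneg hNv (by linarith)
  refine (hB.pos_of_orthogonal (N + l • X) v ?_ ?_ hv).not_ge hvv
  · have hlX : l * B X N ≤ 0 := mul_nonpos_of_nonneg_of_nonpos hl hXN.le
    have hlXX : l * (l * B X X) ≤ 0 :=
      mul_nonpos_of_nonneg_of_nonpos hl (mul_nonpos_of_nonneg_of_nonpos hl hX.le)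
    simp only [map_add, map_smul, LinearMap.add_apply, LinearMap.smul_apply, smul_eq_mul,
      hB.eq N X]
    linarith
  · simp [l, div_neg, hXv'.ne]

theorem IsLorentzForm.sqrt_lt_neg_apply (hB : IsLorentzForm B) {X N v : V} (hX : B X X < 0)
    (hN : B N N < -1) (hXN : B X N < 0) (hv : v ≠ 0) (hvv : B v v ≤ 0) (hXv : B X v ≤ 0) :
    √(-B v v) < -B N v := by
  have hN0 : B N N < 0 := hN.trans (by norm_num)
  have hNv : B N v < 0 := hB.apply_neg_of_causal hX hN0 hXN hv hvv hXv
  rw [Real.sqrt_lt' (neg_pos.2 hNv), neg_sq]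
  rcases hvv.eq_or_lt with h0 | hlt
  · rw [h0, neg_zero]
    exact sq_pos_of_neg hNv
  · calc -B v v < B N N * B v v := by nlinarith
      _ ≤ B N v ^ 2 := hB.apply_self_mul_apply_self_le_sq hN0 v

/-- A converse of the reverse Cauchy–Schwarz inequality. -/
theorem apply_self_le_neg_one_of_forall_sqrt_le (hB : B.IsSymm) {X P : V} (hX : B X X < 0)
    (hP : ∀ W, B W W < 0 → B X W < 0 → √(-B W W) ≤ B P W) : B P P ≤ -1 := by
  have hPX : 0 < B P X := (Real.sqrt_pos.2 (neg_pos.2 hX)).trans_le (hP X hX hX)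
  have hXP : B X P = B P X := hB.eq X P
  rcases lt_or_ge (B P P) 0 with hneg | hnonneg
  · have h := hP (-P) (by simpa) (by simpa [hXP])
    simp only [map_neg, LinearMap.neg_apply, neg_neg] at h
    have hsq := Real.sq_sqrt (neg_nonneg.2 hneg.le)
    have hpos := Real.sqrt_pos.2 (neg_pos.2 hneg)
    nlinarith
  · -- The test vector pairs to `1` with `P`, but its length exceeds `1`.
    exfalso
    set ε := (B P P + 1) / B P X
    have hε0 : 0 < ε := by positivity
    have hεX : ε * B P X = B P P + 1 := div_mul_cancel₀ _ hPX.ne'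
    have hWW : B (ε • X - P) (ε • X - P) < -1 := by
      have : ε * (ε * B X X) < 0 := mul_neg_of_pos_of_neg hε0 (mul_neg_of_pos_of_neg hε0 hX)
      simp only [map_sub, map_smul, LinearMap.sub_apply, LinearMap.smul_apply, smul_eq_mul, hXP]
      linarith
    have hXW : B X (ε • X - P) < 0 := by
      have : ε * B X X < 0 := mul_neg_of_pos_of_neg hε0 hX
      simp only [map_sub, map_smul, smul_eq_mul, hXP]
      linarith
    have hPW : B P (ε • X - P) = 1 := by
      simp only [map_sub, map_smul, smul_eq_mul]
      linarith
    have h := hP (ε • X - P) (hWW.trans (by norm_num)) hXW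
    rw [hPW, Real.sqrt_le_one] at h
    linarith

end LorentzForm

section NormedLorentzForm

variable {F : Type*} [NormedAddCommGroup F] [NormedSpace ℝ F] [FiniteDimensional ℝ F]
  {B : LinearMap.BilinForm ℝ F}

theorem continuous_bilinForm_apply (B : LinearMap.BilinForm ℝ F) :
    Continuous fun v : F × F ↦ B v.1 v.2 :=
  B.toContinuousBilinearMap.continuous₂

theorem IsLorentzForm.exists_pos_forall_sphere (hB : IsLorentzForm B) {X N : F}
    (hX : B X X < 0) (hN : B N N < -1) (hXN : B X N < 0) :
    ∃ m > 0, ∀ v, ‖v‖ = 1 → B v v < m → B X v < m → √(-B v v) + m ≤ -B N v := by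
  have hBc := continuous_bilinForm_apply B
  let f : F → ℝ := fun v ↦ max (B v v) (max (B X v) (-B N v - √(-B v v)))
  have hf : Continuous f := by
    have hBX : Continuous fun v ↦ B X v := hBc.comp (by fun_prop : Continuous fun v ↦ (X, v))
    have hBN : Continuous fun v ↦ B N v := hBc.comp (by fun_prop : Continuous fun v ↦ (N, v))
    have hBB : Continuous fun v ↦ B v v := hBc.comp (by fun_prop : Continuous fun v ↦ (v, v))
    exact hBB.max (hBX.max (hBN.neg.sub hBB.neg.sqrt))
  have hpos : ∀ v ∈ Metric.sphere (0 : F) 1, 0 < f v := by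
    intro v hv
    by_contra! hle
    simp only [f, max_le_iff] at hle
    have := hB.sqrt_lt_neg_apply hX hN hXN (ne_zero_of_mem_unit_sphere ⟨v, hv⟩) hle.1 hle.2.1
    linarith [hle.2.2]
  have : ProperSpace F := FiniteDimensional.proper ℝ F
  obtain ⟨m, hm, hmf⟩ : ∃ m > 0, ∀ v ∈ Metric.sphere (0 : F) 1, m ≤ f v :=
    (isCompact_sphere (0 : F) 1).exists_forall_le' hf.continuousOn hpos
  refine ⟨m, hm, fun v hv hvv hXv ↦ ?_⟩
  have h := hmf v (mem_sphere_zero_iff_norm.2 hv)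
  simp only [f, le_max_iff, hvv.not_ge, hXv.not_ge, false_or] at h
  linarith

theorem IsLorentzForm.exists_sqrt_add_le (hB : IsLorentzForm B) {X N : F}
    (hX : B X X < 0) (hN : B N N < -1) (hXN : B X N < 0) :
    ∃ δ > 0, ∀ v, B v v ≤ δ * ‖v‖ ^ 2 → B X v ≤ δ * ‖v‖ →
      √(δ * ‖v‖ ^ 2 - B v v) + δ * ‖v‖ ≤ -B N v := by
  obtain ⟨m, hm, hmB⟩ := hB.exists_pos_forall_sphere hX hN hXN
  obtain ⟨s, hs, hsm⟩ : ∃ s > 0, s + s ^ 2 < m :=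
    ⟨min (1 / 2) (m / 2), by positivity, by
      nlinarith [min_le_left (1 / 2) (m / 2), min_le_right (1 / 2) (m / 2),
        show 0 < min (1 / 2) (m / 2) by positivity]⟩
  refine ⟨s ^ 2, by positivity, fun v hvv hXv ↦ ?_⟩
  rcases eq_or_ne v 0 with rfl | hv
  · simp
  obtain ⟨r, hr, w, hw, rfl⟩ : ∃ r > 0, ∃ w : F, ‖w‖ = 1 ∧ v = r • w :=
    ⟨‖v‖, norm_pos_iff.2 hv, ‖v‖⁻¹ • v, by simp [norm_smul, hv], by simp [smul_smul, hv]⟩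
  simp only [norm_smul, hw, Real.norm_of_nonneg hr.le, map_smul, LinearMap.smul_apply,
    smul_eq_mul, mul_one] at hvv hXv ⊢
  have hww : B w w ≤ s ^ 2 := by
    refine le_of_mul_le_mul_left ?_ (pow_pos hr 2)
    linarith
  have hXw : B X w ≤ s ^ 2 := le_of_mul_le_mul_left (by linarith) hr
  have hsqrt : √(s ^ 2 - B w w) ≤ s + √(-B w w) := by
    have hsq : -B w w ≤ √(-B w w) ^ 2 := Real.sq_sqrt' (x := -B w w) ▸ le_max_left _ _
    have : 0 ≤ s * √(-B w w) := by positivity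
    exact Real.sqrt_le_iff.2 ⟨by positivity, by linarith [add_sq s √(-B w w)]⟩
  have hw' := hmB w hw (by nlinarith) (by nlinarith)
  calc √(s ^ 2 * r ^ 2 - r * (r * B w w)) + s ^ 2 * r
      = r * (√(s ^ 2 - B w w) + s ^ 2) := by
        rw [show s ^ 2 * r ^ 2 - r * (r * B w w) = r ^ 2 * (s ^ 2 - B w w) by ring,
          Real.sqrt_mul (sq_nonneg r), Real.sqrt_sq hr.le]
        ring
    _ ≤ r * -B N w := by gcongr; linarith
    _ = -(r * B N w) := by ring

end NormedLorentzForm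

/-! ### Tangent vectors in chart coordinates -/

section ChartCoordinates

variable {E : Type*} [NormedAddCommGroup E] [NormedSpace ℝ E] {M : Type*} [TopologicalSpace M]
  [ChartedSpace E M] [IsManifold 𝓘(ℝ, E) 1 M]

/-- The coordinates, in the chart at `c`, of the tangent vectors at `p`; only meaningful if `p` lies
in the source of that chart. -/
noncomputable def chartCoord (c p : M) : TangentSpace 𝓘(ℝ, E) p →L[ℝ] E :=
  (trivializationAt E (TangentSpace 𝓘(ℝ, E)) c).continuousLinearMapAt ℝ p

theorem chartCoord_self (c : M) (v : TangentSpace 𝓘(ℝ, E) c) : chartCoord c c v = (v : E) := by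
  rw [chartCoord,
    TangentBundle.continuousLinearMapAt_trivializationAt_eq_core (mem_chart_source _ c)]
  exact (tangentBundleCore 𝓘(ℝ, E) M).coordChange_self (achart _ c) c (mem_chart_source _ c) v

theorem chartCoord_eq_mfderiv {c p : M} (hp : p ∈ (chartAt E c).source) :
    chartCoord c p = mfderiv 𝓘(ℝ, E) 𝓘(ℝ, E) (extChartAt 𝓘(ℝ, E) c) p :=
  TangentBundle.continuousLinearMapAt_trivializationAt hp

theorem symm_chartCoord {c p : M} (hp : p ∈ (chartAt E c).source) (v : TangentSpace 𝓘(ℝ, E) p) :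
    (trivializationAt E (TangentSpace 𝓘(ℝ, E)) c).symm p (chartCoord c p v) = v := by
  have hp' : p ∈ (trivializationAt E (TangentSpace 𝓘(ℝ, E) : M → Type _) c).baseSet := by simpa
  exact (Trivialization.symmL_apply (R := ℝ) _ hp' _).symm.trans
    (Trivialization.symmL_continuousLinearMapAt _ hp' v)

theorem continuousAt_chartCoord_section {X : ∀ p : M, TangentSpace 𝓘(ℝ, E) p} {c : M}
    (hX : ContinuousAt (fun p ↦ (⟨p, X p⟩ : TangentBundle 𝓘(ℝ, E) M)) c) :
    ContinuousAt (fun p ↦ chartCoord c p (X p)) c := by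
  rw [FiberBundle.continuousAt_totalSpace] at hX
  refine hX.2.congr ?_
  filter_upwards [chart_source_mem_nhds E c] with p hp
  rw [chartCoord, Trivialization.continuousLinearMapAt_apply, Trivialization.linearMapAt_apply,
    if_pos (by simpa using hp)]

theorem exists_continuousAt_apply_chartCoord
    {g : ∀ p : M, TangentSpace 𝓘(ℝ, E) p →L[ℝ] TangentSpace 𝓘(ℝ, E) p →L[ℝ] ℝ} {c : M}
    (hg : ContinuousAt (fun p ↦ TotalSpace.mk' (E →L[ℝ] E →L[ℝ] ℝ) p (g p)) c) :
    ∃ G : M → (E →L[ℝ] E →L[ℝ] ℝ), ContinuousAt G c ∧ ∀ p ∈ (chartAt E c).source,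
      ∀ V W : TangentSpace 𝓘(ℝ, E) p, g p V W = G p (chartCoord c p V) (chartCoord c p W) := by
  rw [continuousAt_hom_bundle] at hg
  refine ⟨_, hg.2, fun p hp V W ↦ ?_⟩
  have hp' : p ∈ (trivializationAt E (TangentSpace 𝓘(ℝ, E) : M → Type _) c).baseSet := by simpa
  have hline : ∀ r : ℝ,
      Trivialization.linearMapAt ℝ (trivializationAt ℝ (Bundle.Trivial M ℝ) c) p r = r := by simp
  rw [inCoordinates_apply_eq₂ hp' hp' (by simp), symm_chartCoord hp, symm_chartCoord hp]
  exact (hline _).symm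

theorem hasDerivWithinAt_extChartAt_comp {c : M} {γ : ℝ → M} {s : Set ℝ} {t : ℝ}
    (hγ : MDifferentiableWithinAt 𝓘(ℝ, ℝ) 𝓘(ℝ, E) γ s t) (ht : γ t ∈ (chartAt E c).source) :
    HasDerivWithinAt (fun τ ↦ extChartAt 𝓘(ℝ, E) c (γ τ))
      (chartCoord c (γ t) (mfderivWithin 𝓘(ℝ, ℝ) 𝓘(ℝ, E) γ s t (1 : ℝ))) s t := by
  have hψ := (mdifferentiableAt_extChartAt (I := 𝓘(ℝ, E)) ht).hasMFDerivAt
  have hψγ := hψ.comp_hasMFDerivWithinAt t hγ.hasMFDerivWithinAt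
  rw [← chartCoord_eq_mfderiv ht] at hψγ
  let L : ℝ →L[ℝ] E := (chartCoord c (γ t)).comp (mfderivWithin 𝓘(ℝ, ℝ) 𝓘(ℝ, E) γ s t)
  have hL : HasFDerivWithinAt (fun τ ↦ extChartAt 𝓘(ℝ, E) c (γ τ)) L s t :=
    hasMFDerivWithinAt_iff_hasFDerivWithinAt.1 hψγ
  exact hL.hasDerivWithinAt

theorem chartCoord_mfderivWithin_symm_comp {c : M} {η : ℝ → E} {s : Set ℝ} {t : ℝ} {v : E}
    (hs : UniqueDiffWithinAt ℝ s t) (hη : HasDerivWithinAt η v s t) (hts : t ∈ s)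
    (hmaps : MapsTo η s (extChartAt 𝓘(ℝ, E) c).target) :
    chartCoord c ((extChartAt 𝓘(ℝ, E) c).symm (η t))
      (mfderivWithin 𝓘(ℝ, ℝ) 𝓘(ℝ, E) (fun τ ↦ (extChartAt 𝓘(ℝ, E) c).symm (η τ)) s t (1 : ℝ)) =
      v := by
  have hsource : (extChartAt 𝓘(ℝ, E) c).symm (η t) ∈ (chartAt E c).source := by
    rw [← extChartAt_source 𝓘(ℝ, E)]
    exact (extChartAt 𝓘(ℝ, E) c).map_target (hmaps hts)
  have hdiff : MDifferentiableWithinAt 𝓘(ℝ, ℝ) 𝓘(ℝ, E)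
      (fun τ ↦ (extChartAt 𝓘(ℝ, E) c).symm (η τ)) s t :=
    ((contMDiffOn_extChartAt_symm (I := 𝓘(ℝ, E)) (n := 1) c).mdifferentiableOn one_ne_zero (η t)
      (hmaps hts)).comp t hη.hasFDerivWithinAt.differentiableWithinAt.mdifferentiableWithinAt hmaps
  have hright : EqOn (fun τ ↦ extChartAt 𝓘(ℝ, E) c ((extChartAt 𝓘(ℝ, E) c).symm (η τ))) η s :=
    fun τ hτ ↦ (extChartAt 𝓘(ℝ, E) c).right_inv (hmaps hτ)
  exact hs.eq_deriv _ (hasDerivWithinAt_extChartAt_comp hdiff hsource)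
    (hη.congr hright (hright hts))

theorem continuousOn_apply_mfderivWithin
    {g : ∀ p : M, TangentSpace 𝓘(ℝ, E) p →L[ℝ] TangentSpace 𝓘(ℝ, E) p →L[ℝ] ℝ}
    (hg : Continuous (fun p ↦ TotalSpace.mk' (E →L[ℝ] E →L[ℝ] ℝ) p (g p)))
    {γ : ℝ → M} {s : Set ℝ} (hs : UniqueDiffOn ℝ s) (hγ : ContMDiffOn 𝓘(ℝ, ℝ) 𝓘(ℝ, E) 1 γ s) :
    ContinuousOn (fun t ↦ g (γ t) (mfderivWithin 𝓘(ℝ, ℝ) 𝓘(ℝ, E) γ s t (1 : ℝ))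
      (mfderivWithin 𝓘(ℝ, ℝ) 𝓘(ℝ, E) γ s t (1 : ℝ))) s := by
  have hone : Continuous (fun t : ℝ ↦ (⟨t, (1 : ℝ)⟩ : TangentBundle 𝓘(ℝ, ℝ) ℝ)) :=
    (tangentBundleModelSpaceHomeomorph 𝓘(ℝ, ℝ)).symm.continuous.comp
      (by fun_prop : Continuous fun t : ℝ ↦ (t, (1 : ℝ)))
  have hvel : ContinuousOn (fun t ↦ TotalSpace.mk' E (γ t)
      (mfderivWithin 𝓘(ℝ, ℝ) 𝓘(ℝ, E) γ s t (1 : ℝ))) s :=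
    (hγ.continuousOn_tangentMapWithin le_rfl hs.uniqueMDiffOn).comp hone.continuousOn
      (fun t ht ↦ ht)
  intro t ht
  have hgγ : ContinuousWithinAt (fun t ↦ TotalSpace.mk' (E →L[ℝ] E →L[ℝ] ℝ)
      (E := fun x : M ↦ TangentSpace 𝓘(ℝ, E) x →L[ℝ] TangentSpace 𝓘(ℝ, E) x →L[ℝ] ℝ)
      (γ t) (g (γ t))) s t :=
    hg.continuousAt.comp_continuousWithinAt (hγ.continuousOn t ht)
  have h := ContinuousWithinAt.clm_bundle_apply₂ (F₁ := E) (F₂ := E) (F₃ := ℝ)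
    (E₃ := Bundle.Trivial M ℝ) hgγ (hvel t ht) (hvel t ht)
  rw [FiberBundle.continuousWithinAt_totalSpace] at h
  exact h.2

end ChartCoordinates

section ContinuousBilinear

variable {F α : Type*} [NormedAddCommGroup F] [NormedSpace ℝ F] [TopologicalSpace α] {c : α}

theorem eventually_abs_apply_sub_le {L : α → F →L[ℝ] ℝ} (hL : ContinuousAt L c) {ε : ℝ}
    (hε : 0 < ε) : ∀ᶠ p in 𝓝 c, ∀ v, |L p v - L c v| ≤ ε * ‖v‖ := by
  filter_upwards [hL.eventually (eventually_norm_sub_lt (L c) hε)] with p hp v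
  exact ((L p - L c).le_opNorm v).trans (by gcongr)

theorem eventually_abs_apply_apply_sub_le {G : α → F →L[ℝ] F →L[ℝ] ℝ} (hG : ContinuousAt G c)
    {ε : ℝ} (hε : 0 < ε) : ∀ᶠ p in 𝓝 c, ∀ v, |G p v v - G c v v| ≤ ε * ‖v‖ ^ 2 := by
  -- Instance search does not find this structure in time.
  let : NormedAddCommGroup (F →L[ℝ] F →L[ℝ] ℝ) := ContinuousLinearMap.toNormedAddCommGroup
  filter_upwards [hG.eventually (eventually_norm_sub_lt (G c) hε)] with p hp v
  refine ((G p - G c).le_opNorm₂ v v).trans ?_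
  rw [mul_assoc, ← pow_two]
  gcongr

end ContinuousBilinear

section MetricInCoordinates

variable {n : ℕ} {M : Type*} [TopologicalSpace M]
  [ChartedSpace (EuclideanSpace ℝ (Fin (n + 1))) M] [IsManifold (𝓡 (n + 1)) ∞ M]

/-- The metric at `c`, as a bilinear form on the model space. -/
noncomputable def LorentzianMetric.form (g : LorentzianMetric n M) (c : M) :
    LinearMap.BilinForm ℝ (EuclideanSpace ℝ (Fin (n + 1))) :=
  g.flat c

/-- The time-orienting vector at `c`, as a vector of the model space. -/
def SpaceTime.vec (S : SpaceTime n M) (c : M) : EuclideanSpace ℝ (Fin (n + 1)) := S.X c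

theorem LorentzianMetric.isLorentzForm_form (g : LorentzianMetric n M) (c : M) :
    IsLorentzForm (g.form c) := by
  obtain ⟨e, he⟩ := g.signature c
  exact IsLorentzForm.of_basis (V := TangentSpace (𝓡 (n + 1)) c) (B := g.flat c) e 0 he

theorem SpaceTime.form_vec_vec_neg (S : SpaceTime n M) (c : M) :
    S.form c (S.vec c) (S.vec c) < 0 :=
  S.X_timelike c

theorem SpaceTime.eventually_abs_val_sub_form_le (S : SpaceTime n M) (c : M) {ε : ℝ}
    (hε : 0 < ε) : ∀ᶠ p in 𝓝 c, ∀ V : TangentSpace (𝓡 (n + 1)) p,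
      |S.val p V V - S.form c (chartCoord c p V) (chartCoord c p V)| ≤ ε * ‖chartCoord c p V‖ ^ 2 ∧
      |S.val p (S.X p) V - S.form c (S.vec c) (chartCoord c p V)| ≤ ε * ‖chartCoord c p V‖ := by
  obtain ⟨G, hG, hval⟩ :=
    exists_continuousAt_apply_chartCoord (S.smooth.continuous.continuousAt (x := c))
  have hform : ∀ v w, S.form c v w = G c v w := fun v w ↦
    (hval c (mem_chart_source _ c) v w).trans
      (congrArg₂ (fun v w ↦ G c v w) (chartCoord_self c v) (chartCoord_self c w))
  have hvec : chartCoord c c (S.X c) = S.vec c := chartCoord_self c _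
  have hX := continuousAt_chartCoord_section (S.X_continuous.continuousAt (x := c))
  filter_upwards [eventually_abs_apply_apply_sub_le hG hε,
    eventually_abs_apply_sub_le (hG.clm_apply hX) hε,
    chart_source_mem_nhds (EuclideanSpace ℝ (Fin (n + 1))) c] with p hGp hXp hp V
  rw [hvec] at hXp
  rw [hval p hp, hval p hp, hform, hform]
  exact ⟨hGp _, hXp _⟩

end MetricInCoordinates

/-! ### Piecewise `C¹` curves -/

section Reparametrization

variable {E M : Type*} [NormedAddCommGroup E] [NormedSpace ℝ E] [TopologicalSpace M]
  [ChartedSpace E M] {γ : ℝ → M} {f : ℝ → ℝ} {s s' : Set ℝ}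

theorem mfderivWithin_comp_apply_one {t k : ℝ}
    (hγ : MDifferentiableWithinAt 𝓘(ℝ, ℝ) 𝓘(ℝ, E) γ s (f t)) (hf : HasDerivWithinAt f k s' t)
    (hs' : UniqueDiffWithinAt ℝ s' t) (hmaps : MapsTo f s' s) :
    mfderivWithin 𝓘(ℝ, ℝ) 𝓘(ℝ, E) (fun τ ↦ γ (f τ)) s' t (1 : ℝ) =
      k • mfderivWithin 𝓘(ℝ, ℝ) 𝓘(ℝ, E) γ s (f t) (1 : ℝ) := by
  have hcomp := hγ.hasMFDerivWithinAt.comp t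
    (hasMFDerivWithinAt_iff_hasFDerivWithinAt.2 hf.hasFDerivWithinAt) hmaps
  have hderiv := hcomp.mfderivWithin hs'.uniqueMDiffWithinAt
  let L : ℝ →L[ℝ] TangentSpace 𝓘(ℝ, E) (γ (f t)) := mfderivWithin 𝓘(ℝ, ℝ) 𝓘(ℝ, E) γ s (f t)
  have hone : ContinuousLinearMap.toSpanSingleton ℝ k (1 : ℝ) = k • (1 : ℝ) := by simp
  exact (DFunLike.congr_fun hderiv (1 : ℝ)).trans
    ((congrArg L hone).trans (map_smul L k (1 : ℝ)))

end Reparametrization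

namespace SpaceTime

variable {n : ℕ} {M : Type*} [TopologicalSpace M] [ChartedSpace (EuclideanSpace ℝ (Fin (n + 1))) M]

section PiecewiseC1

variable {P Q : ∀ x : M, TangentSpace (𝓡 (n + 1)) x → Prop} {γ γ' : ℝ → M} {a b c : ℝ}

theorem pred_of_eq {x y : M} {v : TangentSpace (𝓡 (n + 1)) x} {w : TangentSpace (𝓡 (n + 1)) y}
    (hxy : x = y) (hvw : (v : EuclideanSpace ℝ (Fin (n + 1))) = w) (h : P x v) : P y w := by
  subst hxy
  obtain rfl : v = w := hvw
  exact h

theorem IsPiecewiseC1With.mono (h : IsPiecewiseC1With P γ a b) (hPQ : ∀ x V, P x V → Q x V) :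
    IsPiecewiseC1With Q γ a b := by
  obtain ⟨hab, hγ, B, hB⟩ := h
  exact ⟨hab, hγ, B, fun c d hac hcd hdb hBcd ↦
    (hB c d hac hcd hdb hBcd).imp_right fun hP t ht ↦ hPQ _ _ (hP t ht)⟩

theorem IsPiecewiseC1With.restrict (h : IsPiecewiseC1With P γ a b) {c d : ℝ} (hac : a ≤ c)
    (hcd : c < d) (hdb : d ≤ b) : IsPiecewiseC1With P γ c d := by
  obtain ⟨-, hγ, B, hB⟩ := h
  exact ⟨hcd, hγ.mono (Icc_subset_Icc hac hdb), B, fun c' d' hc hcd' hd ↦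
    hB c' d' (hac.trans hc) hcd' (hd.trans hdb)⟩

theorem IsPiecewiseC1With.congr (h : IsPiecewiseC1With P γ a b) (heq : EqOn γ' γ (Icc a b)) :
    IsPiecewiseC1With P γ' a b := by
  obtain ⟨hab, hγ, B, hB⟩ := h
  refine ⟨hab, hγ.congr heq, B, fun c d hac hcd hdb hBcd ↦ ?_⟩
  obtain ⟨hC1, hP⟩ := hB c d hac hcd hdb hBcd
  have heq' : EqOn γ' γ (Icc c d) := heq.mono (Icc_subset_Icc hac hdb)
  refine ⟨hC1.congr heq', fun t ht ↦ pred_of_eq (heq' ht).symm ?_ (hP t ht)⟩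
  have hderiv := mfderivWithin_congr (I := 𝓘(ℝ, ℝ)) (I' := 𝓡 (n + 1)) heq' (heq' ht)
  exact (DFunLike.congr_fun hderiv (1 : ℝ)).symm

theorem IsPiecewiseC1With.trans (h₁ : IsPiecewiseC1With P γ a b) (h₂ : IsPiecewiseC1With P γ b c) :
    IsPiecewiseC1With P γ a c := by
  obtain ⟨hab, hγ₁, B₁, hB₁⟩ := h₁
  obtain ⟨hbc, hγ₂, B₂, hB₂⟩ := h₂
  refine ⟨hab.trans hbc, ?_, insert b (B₁ ∪ B₂), fun c' d' hac hcd hdc hB ↦ ?_⟩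
  · rw [← Icc_union_Icc_eq_Icc hab.le hbc.le]
    exact hγ₁.union_of_isClosed hγ₂ isClosed_Icc isClosed_Icc
  have hb : b ∉ Ioo c' d' := hB b (by simp)
  rcases le_or_gt d' b with hdb | hbd
  · exact hB₁ c' d' hac hcd hdb fun t ht ↦ hB t (by simp [ht])
  · exact hB₂ c' d' (not_lt.1 fun hcb ↦ hb ⟨hcb, hbd⟩) hcd hdc fun t ht ↦ hB t (by simp [ht])

theorem IsPiecewiseC1With.concat (h₁ : IsPiecewiseC1With P γ a b)
    (h₂ : IsPiecewiseC1With P γ' b c) (hb : γ b = γ' b) :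
    IsPiecewiseC1With P (fun t ↦ if t ≤ b then γ t else γ' t) a c := by
  refine (h₁.congr fun t ht ↦ if_pos ht.2).trans (h₂.congr fun t ht ↦ ?_)
  rcases ht.1.eq_or_lt with rfl | hlt
  · simp [hb]
  · exact if_neg hlt.not_ge

theorem IsPiecewiseC1With.comp_mul_add {k m : ℝ} (hk : 0 < k)
    (h : IsPiecewiseC1With P γ (k * a + m) (k * b + m)) (hPQ : ∀ x V, P x V → Q x (k • V)) :
    IsPiecewiseC1With Q (fun t ↦ γ (k * t + m)) a b := by
  obtain ⟨hab, hγ, B, hB⟩ := h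
  have hmaps (c d : ℝ) : MapsTo (fun t ↦ k * t + m) (Icc c d) (Icc (k * c + m) (k * d + m)) :=
    fun t ht ↦
    ⟨by simpa [hk] using ht.1, by simpa [hk] using ht.2⟩
  have hsmooth : ContDiff ℝ 1 (fun t : ℝ ↦ k * t + m) := by fun_prop
  refine ⟨by nlinarith, hγ.comp (by fun_prop) (hmaps a b), B.image (fun t ↦ (t - m) / k),
    fun c d hac hcd hdb hBcd ↦ ?_⟩
  obtain ⟨hC1, hP⟩ := hB (k * c + m) (k * d + m) (by gcongr) (by gcongr) (by gcongr) fun t ht hm ↦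
    hBcd ((t - m) / k) (Finset.mem_image_of_mem _ ht)
      ⟨by rw [lt_div_iff₀ hk]; linarith [hm.1], by rw [div_lt_iff₀ hk]; linarith [hm.2]⟩
  refine ⟨hC1.comp hsmooth.contMDiff.contMDiffOn (hmaps c d), fun t ht ↦ ?_⟩
  have hderiv : HasDerivWithinAt (fun t ↦ k * t + m) k (Icc c d) t := by
    simpa using (((hasDerivAt_id t).const_mul k).add_const m).hasDerivWithinAt
  rw [mfderivWithin_comp_apply_one (f := fun t ↦ k * t + m)
    (hC1.mdifferentiableOn one_ne_zero _ (hmaps c d ht)) hderiv (uniqueDiffOn_Icc hcd t ht)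
    (hmaps c d)]
  exact hPQ _ _ (hP _ (hmaps c d ht))

theorem IsPiecewiseC1With.comp_neg (h : IsPiecewiseC1With P γ a b)
    (hPQ : ∀ x V, P x V → Q x (-V)) : IsPiecewiseC1With Q (fun t ↦ γ (-t)) (-b) (-a) := by
  obtain ⟨hab, hγ, B, hB⟩ := h
  have hmaps (c d : ℝ) : MapsTo (fun t : ℝ ↦ -t) (Icc c d) (Icc (-d) (-c)) :=
    fun t ht ↦ ⟨neg_le_neg ht.2, neg_le_neg ht.1⟩
  refine ⟨neg_lt_neg hab, hγ.comp (by fun_prop) (by simpa using hmaps (-b) (-a)),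
    B.image (fun t ↦ -t), fun c d hac hcd hdb hBcd ↦ ?_⟩
  obtain ⟨hC1, hP⟩ := hB (-d) (-c) (by linarith) (by linarith) (by linarith) fun t ht hm ↦
    hBcd (-t) (Finset.mem_image_of_mem _ ht) ⟨by linarith [hm.2], by linarith [hm.1]⟩
  refine ⟨hC1.comp contDiff_neg.contMDiff.contMDiffOn (hmaps c d), fun t ht ↦ ?_⟩
  rw [mfderivWithin_comp_apply_one (hC1.mdifferentiableOn one_ne_zero _ (hmaps c d ht))
    (hasDerivAt_neg t).hasDerivWithinAt (uniqueDiffOn_Icc hcd t ht) (hmaps c d), neg_one_smul]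
  exact hPQ _ _ (hP _ (hmaps c d ht))

theorem IsPiecewiseC1With.piece_induction {R : ℝ → ℝ → Prop} (h : IsPiecewiseC1With P γ a b)
    (hadd : ∀ c d e, a ≤ c → c < d → d < e → e ≤ b → R c d → R d e → R c e)
    (hpiece : ∀ c d, a ≤ c → c < d → d ≤ b →
      ContMDiffOn 𝓘(ℝ, ℝ) (𝓡 (n + 1)) 1 γ (Icc c d) →
      (∀ t ∈ Icc c d, P (γ t) (mfderivWithin 𝓘(ℝ, ℝ) (𝓡 (n + 1)) γ (Icc c d) t (1 : ℝ))) →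
      R c d) : R a b := by
  obtain ⟨hab, -, B, hB⟩ := h
  suffices key : ∀ B' : Finset ℝ, ∀ c d, a ≤ c → c < d → d ≤ b →
      (∀ t ∈ B, t ∈ Ioo c d → t ∈ B') → R c d from
    key B a b le_rfl hab le_rfl fun t ht _ ↦ ht
  intro B'
  induction B' using Finset.induction_on with
  | empty =>
    intro c d hac hcd hdb hempty
    obtain ⟨hC1, hP⟩ := hB c d hac hcd hdb fun t ht hm ↦ by simpa using hempty t ht hm
    exact hpiece c d hac hcd hdb hC1 hP
  | insert s B' _ ih =>
    intro c d hac hcd hdb hinsert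
    by_cases hs : s ∈ Ioo c d
    · refine hadd c s d hac hs.1 hs.2 hdb (ih c s hac hs.1 (hs.2.le.trans hdb) fun t ht hm ↦ ?_)
        (ih s d (hac.trans hs.1.le) hs.2 hdb fun t ht hm ↦ ?_)
      · exact (Finset.mem_insert.1 (hinsert t ht ⟨hm.1, hm.2.trans hs.2⟩)).resolve_left hm.2.ne
      · exact (Finset.mem_insert.1 (hinsert t ht ⟨hs.1.trans hm.1, hm.2⟩)).resolve_left hm.1.ne'
    · exact ih c d hac hcd hdb fun t ht hm ↦
        (Finset.mem_insert.1 (hinsert t ht hm)).resolve_left fun hts ↦ hs (hts ▸ hm)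

theorem IsPiecewiseC1With.exists_unit_interval
    (hP : ∀ x V, ∀ k : ℝ, 0 < k → P x V → P x (k • V)) (h : IsPiecewiseC1With P γ a b) (s : ℝ) :
    ∃ σ : ℝ → M, IsPiecewiseC1With P σ s (s + 1) ∧ σ s = γ a ∧ σ (s + 1) = γ b := by
  have hab : 0 < b - a := sub_pos.2 h.1
  refine ⟨fun t ↦ γ ((b - a) * t + (a - (b - a) * s)), ?_, ?_, ?_⟩
  · refine IsPiecewiseC1With.comp_mul_add hab ?_ (fun x V ↦ hP x V _ hab)
    convert h using 1 <;> ring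
  · dsimp only; congr 1; ring
  · dsimp only; congr 1; ring

/-- There is a piecewise `C¹` curve from `p` to `q` whose tangent vectors satisfy `P`. For the two
classes of future-directed curves this is the chronological and the strict causal relation. -/
def JoinedBy (P : ∀ x : M, TangentSpace (𝓡 (n + 1)) x → Prop) (p q : M) : Prop :=
  ∃ (γ : ℝ → M) (a b : ℝ), IsPiecewiseC1With P γ a b ∧ γ a = p ∧ γ b = q

theorem JoinedBy.trans {p q r : M} (hP : ∀ x V, ∀ k : ℝ, 0 < k → P x V → P x (k • V))
    (hpq : JoinedBy P p q) (hqr : JoinedBy P q r) : JoinedBy P p r := by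
  obtain ⟨γ₁, a, b, h₁, rfl, rfl⟩ := hpq
  obtain ⟨γ₂, c, d, h₂, hq, rfl⟩ := hqr
  obtain ⟨σ, hσ, hσ_left, hσ_right⟩ := h₂.exists_unit_interval hP b
  refine ⟨_, _, _, h₁.concat hσ (by rw [hσ_left, hq]), ?_, ?_⟩
  · simp [h₁.1.le]
  · simp [hσ_right]

end PiecewiseC1

/-! ### The causal relations -/

section Causality

variable [IsManifold (𝓡 (n + 1)) ∞ M] {S : SpaceTime n M} {γ : ℝ → M} {a b : ℝ} {p q r x : M}
  {V : TangentSpace (𝓡 (n + 1)) x}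

theorem IsFutureDirected.smul {k : ℝ} (hk : 0 < k) (h : S.IsFutureDirected V) :
    S.IsFutureDirected (k • V) := by
  obtain ⟨⟨hne, hcausal⟩, hfuture⟩ := h
  refine ⟨⟨smul_ne_zero hk.ne' hne, ?_⟩, ?_⟩
  · simp only [map_smul, FunLike.coe_smul, Pi.smul_apply, smul_eq_mul]
    exact mul_nonpos_of_nonneg_of_nonpos hk.le (mul_nonpos_of_nonneg_of_nonpos hk.le hcausal)
  · simp only [map_smul, smul_eq_mul]
    exact mul_neg_of_pos_of_neg hk hfuture

theorem IsTimelike.smul {k : ℝ} (hk : 0 < k) (h : S.IsTimelike V) : S.IsTimelike (k • V) := by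
  rw [IsTimelike] at h ⊢
  simp only [map_smul, FunLike.coe_smul, Pi.smul_apply, smul_eq_mul]
  exact mul_neg_of_pos_of_neg hk (mul_neg_of_pos_of_neg hk h)

/-- `p < q`: there is a future-directed causal curve from `p` to `q`. -/
def CausLt (S : SpaceTime n M) (p q : M) : Prop := JoinedBy (fun _ V ↦ S.IsFutureDirected V) p q

theorem IsTimelikeCurve.isCausalCurve (h : S.IsTimelikeCurve γ a b) : S.IsCausalCurve γ a b :=
  IsPiecewiseC1With.mono h fun _ _ hV ↦ hV.2

theorem Chron.causLt (h : S.Chron p q) : S.CausLt p q := by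
  obtain ⟨γ, a, b, hγ, hp, hq⟩ := h
  exact ⟨γ, a, b, hγ.isCausalCurve, hp, hq⟩

theorem Chron.trans (hpq : S.Chron p q) (hqr : S.Chron q r) : S.Chron p r :=
  JoinedBy.trans (fun _ _ _ hk hV ↦ ⟨hV.1.smul hk, hV.2.smul hk⟩) hpq hqr

theorem CausLt.trans (hpq : S.CausLt p q) (hqr : S.CausLt q r) : S.CausLt p r :=
  JoinedBy.trans (fun _ _ _ hk hV ↦ hV.smul hk) hpq hqr

theorem CausLt.trans_caus (hpq : S.CausLt p q) (hqr : S.Caus q r) : S.CausLt p r := by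
  rcases hqr with rfl | hqr
  · exact hpq
  · exact hpq.trans hqr

/-- The space-time with the opposite time orientation. -/
noncomputable def rev (S : SpaceTime n M) : SpaceTime n M where
  toLorentzianMetric := S.toLorentzianMetric
  X := fun x ↦ -S.X x
  X_continuous := by
    have hX : ContMDiff (𝓡 (n + 1)) ((𝓡 (n + 1)).prod 𝓘(ℝ, EuclideanSpace ℝ (Fin (n + 1)))) 0
        (fun x ↦ (TotalSpace.mk' (EuclideanSpace ℝ (Fin (n + 1))) x (S.X x))) :=
      contMDiff_zero_iff.2 S.X_continuous
    exact hX.neg_section.continuous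
  X_timelike := fun x ↦ by simpa using S.X_timelike x

theorem rev_rev (S : SpaceTime n M) : S.rev.rev = S := by
  simp only [rev, neg_neg]

theorem IsTimelike.rev_neg (h : S.IsTimelike V) : S.rev.IsTimelike (-V) := by
  change S.val x (-V) (-V) < 0
  simpa using (show S.val x V V < 0 from h)

theorem IsFutureDirected.rev_neg (h : S.IsFutureDirected V) : S.rev.IsFutureDirected (-V) := by
  obtain ⟨⟨hne, hcausal⟩, hfuture⟩ := h
  refine ⟨⟨neg_ne_zero.2 hne, ?_⟩, ?_⟩
  · change S.val x (-V) (-V) ≤ 0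
    simpa using hcausal
  · change S.val x (-S.X x) (-V) < 0
    simpa using hfuture

theorem Chron.rev (h : S.Chron p q) : S.rev.Chron q p := by
  obtain ⟨γ, a, b, hγ, rfl, rfl⟩ := h
  exact ⟨_, _, _, hγ.comp_neg fun _ _ hV ↦ ⟨hV.1.rev_neg, hV.2.rev_neg⟩, by simp, by simp⟩

theorem chron_rev_iff : S.rev.Chron p q ↔ S.Chron q p :=
  ⟨fun h ↦ by simpa only [rev_rev] using h.rev, fun h ↦ h.rev⟩

end Causality

end SpaceTime

/-! ### Coordinate balls -/

section ChartBall

variable {E H M : Type*} [NormedAddCommGroup E] [NormedSpace ℝ E] [TopologicalSpace H]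
  (I : ModelWithCorners ℝ E H) [TopologicalSpace M] [ChartedSpace H M]

/-- The coordinate ball of radius `r` in the chart at `c`. -/
def chartBall (c : M) (r : ℝ) : Set M :=
  (extChartAt I c).source ∩ extChartAt I c ⁻¹' Metric.ball (extChartAt I c c) r

theorem isOpen_chartBall (c : M) (r : ℝ) : IsOpen (chartBall I c r) :=
  isOpen_extChartAt_preimage' c Metric.isOpen_ball

theorem chartBall_mem_nhds (c : M) {r : ℝ} (hr : 0 < r) : chartBall I c r ∈ 𝓝 c :=
  (isOpen_chartBall I c r).mem_nhds ⟨mem_extChartAt_source c, Metric.mem_ball_self hr⟩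

theorem chartBall_subset_chartBall (c : M) {r R : ℝ} (h : r ≤ R) :
    chartBall I c r ⊆ chartBall I c R :=
  fun _ hp ↦ ⟨hp.1, Metric.ball_subset_ball h hp.2⟩

theorem exists_chartBall_subset [I.Boundaryless] (c : M) {W : Set M} (hW : W ∈ 𝓝 c) :
    ∃ r > 0, Metric.ball (extChartAt I c c) r ⊆ (extChartAt I c).target ∧ chartBall I c r ⊆ W := by
  have hpre : (extChartAt I c).symm ⁻¹' W ∈ 𝓝 (extChartAt I c c) :=
    (continuousAt_extChartAt_symm c).preimage_mem_nhds (by rwa [extChartAt_to_inv])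
  obtain ⟨r, hr, hsub⟩ := Metric.mem_nhds_iff.1 (inter_mem (extChartAt_target_mem_nhds c) hpre)
  refine ⟨r, hr, fun e he ↦ (hsub he).1, fun p hp ↦ ?_⟩
  have hpW := (hsub hp.2).2
  rwa [mem_preimage, (extChartAt I c).left_inv hp.1] at hpW

variable {I} {c : M} {r R : ℝ}

theorem symm_mem_chartBall_iff {e : E} (he : e ∈ (extChartAt I c).target) :
    (extChartAt I c).symm e ∈ chartBall I c r ↔ e ∈ Metric.ball (extChartAt I c c) r := by
  rw [chartBall, mem_inter_iff, mem_preimage, (extChartAt I c).right_inv he]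
  exact and_iff_right ((extChartAt I c).map_target he)

theorem isCompact_symm_image {K : Set E} (hK : IsCompact K) (hsub : K ⊆ (extChartAt I c).target) :
    IsCompact ((extChartAt I c).symm '' K) :=
  hK.image_of_continuousOn ((continuousOn_extChartAt_symm c).mono hsub)

theorem chartBall_subset_symm_image_closedBall :
    chartBall I c r ⊆ (extChartAt I c).symm '' Metric.closedBall (extChartAt I c c) r :=
  fun _ hp ↦ ⟨_, Metric.ball_subset_closedBall hp.2, (extChartAt I c).left_inv hp.1⟩

theorem isCompact_closure_chartBall [ProperSpace E] [T2Space M]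
    (hsub : Metric.closedBall (extChartAt I c c) r ⊆ (extChartAt I c).target) :
    IsCompact (closure (chartBall I c r)) :=
  (isCompact_symm_image (isCompact_closedBall _ r) hsub).closure_of_subset
    chartBall_subset_symm_image_closedBall

theorem closure_chartBall_subset [ProperSpace E] [T2Space M] (hrR : r < R)
    (hsub : Metric.ball (extChartAt I c c) R ⊆ (extChartAt I c).target) :
    closure (chartBall I c r) ⊆ chartBall I c R := by
  have hball := Metric.closedBall_subset_ball (x := extChartAt I c c) hrR
  have hcompact := isCompact_symm_image (isCompact_closedBall _ r) (hball.trans hsub)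
  refine (closure_minimal chartBall_subset_symm_image_closedBall hcompact.isClosed).trans ?_
  rintro _ ⟨e, he, rfl⟩
  exact (symm_mem_chartBall_iff (hsub (hball he))).2 (hball he)

end ChartBall

theorem mapsTo_add_smul_of_convex {E : Type*} [AddCommGroup E] [Module ℝ E] {s : Set E}
    (hs : Convex ℝ s) {e w : E} {a b : ℝ} (ha : e + a • w ∈ s) (hb : e + b • w ∈ s) :
    MapsTo (fun t : ℝ ↦ e + t • w) (Icc a b) s := by
  intro t ht
  obtain ⟨k, hk, rfl⟩ := (segment_eq_image' ℝ a b ▸ Icc_subset_segment ht :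
    t ∈ (fun k ↦ a + k • (b - a)) '' Icc (0 : ℝ) 1)
  convert hs.add_smul_sub_mem ha hb hk using 1
  module

namespace SpaceTime

variable {n : ℕ} {M : Type*} [TopologicalSpace M]
  [ChartedSpace (EuclideanSpace ℝ (Fin (n + 1))) M] [IsManifold (𝓡 (n + 1)) ∞ M]
  {P : ∀ x : M, TangentSpace (𝓡 (n + 1)) x → Prop} {γ γ' : ℝ → M} {a b : ℝ}

/-! ### Length of curves -/

section Length

/-- The Lorentzian norm `√(-g(γ', γ'))` of the velocity of a curve. -/
noncomputable def speed (S : SpaceTime n M) (γ : ℝ → M) (t : ℝ) : ℝ :=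
  √(-S.val (γ t) (mfderiv 𝓘(ℝ, ℝ) (𝓡 (n + 1)) γ t (1 : ℝ))
    (mfderiv 𝓘(ℝ, ℝ) (𝓡 (n + 1)) γ t (1 : ℝ)))

theorem speed_eq_sqrt_mfderivWithin (S : SpaceTime n M) {t : ℝ} (ht : t ∈ Ioo a b) :
    S.speed γ t = √(-S.val (γ t)
      (mfderivWithin 𝓘(ℝ, ℝ) (𝓡 (n + 1)) γ (Icc a b) t (1 : ℝ))
      (mfderivWithin 𝓘(ℝ, ℝ) (𝓡 (n + 1)) γ (Icc a b) t (1 : ℝ))) := by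
  rw [mfderivWithin_of_mem_nhds (Icc_mem_nhds ht.1 ht.2)]
  rfl

theorem speed_congr (S : SpaceTime n M) {t : ℝ} (h : γ' =ᶠ[𝓝 t] γ) :
    S.speed γ' t = S.speed γ t :=
  pred_of_eq (P := fun x V ↦ √(-S.val x V V) = S.speed γ t) h.eq_of_nhds.symm
    (DFunLike.congr_fun (h.mfderiv_eq (I := 𝓘(ℝ, ℝ)) (I' := 𝓡 (n + 1))) (1 : ℝ)).symm rfl

theorem length_congr (S : SpaceTime n M) (hab : a ≤ b) (h : EqOn γ' γ (Icc a b)) :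
    S.length γ' a b = S.length γ a b :=
  intervalIntegral.integral_congr_Ioo_of_le hab fun _ ht ↦
    S.speed_congr (h.eventuallyEq_of_mem (Icc_mem_nhds ht.1 ht.2))

theorem IsPiecewiseC1With.intervalIntegrable_speed (S : SpaceTime n M)
    (h : IsPiecewiseC1With P γ a b) :
    IntervalIntegrable (S.speed γ) MeasureTheory.volume a b := by
  refine h.piece_induction
    (R := fun c d ↦ IntervalIntegrable (S.speed γ) MeasureTheory.volume c d)
    (fun _ _ _ _ _ _ _ hcd hde ↦ hcd.trans hde) fun c d _ hcd _ hC1 _ ↦ ?_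
  have hcont : ContinuousOn (fun t ↦ √(-S.val (γ t)
      (mfderivWithin 𝓘(ℝ, ℝ) (𝓡 (n + 1)) γ (Icc c d) t (1 : ℝ))
      (mfderivWithin 𝓘(ℝ, ℝ) (𝓡 (n + 1)) γ (Icc c d) t (1 : ℝ)))) (Icc c d) :=
    (continuousOn_apply_mfderivWithin S.smooth.continuous (uniqueDiffOn_Icc hcd) hC1).neg.sqrt
  refine (hcont.intervalIntegrable_of_Icc hcd.le).congr_uIoo fun t ht ↦ ?_
  rw [uIoo_of_le hcd.le] at ht
  exact (S.speed_eq_sqrt_mfderivWithin ht).symm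

theorem IsPiecewiseC1With.length_add (S : SpaceTime n M) (h : IsPiecewiseC1With P γ a b)
    {c : ℝ} (hac : a ≤ c) (hcb : c ≤ b) :
    S.length γ a c + S.length γ c b = S.length γ a b := by
  have hint := h.intervalIntegrable_speed S
  refine intervalIntegral.integral_add_adjacent_intervals (hint.mono_set ?_) (hint.mono_set ?_)
  · exact uIcc_subset_uIcc left_mem_uIcc (by simp [uIcc_of_le h.1.le, hac, hcb])
  · exact uIcc_subset_uIcc (by simp [uIcc_of_le h.1.le, hac, hcb]) right_mem_uIcc

theorem IsPiecewiseC1With.mul_le_length (S : SpaceTime n M) {k : ℝ}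
    (h : IsPiecewiseC1With P γ a b) (hk : ∀ x V, P x V → k ≤ √(-S.val x V V)) :
    (b - a) * k ≤ S.length γ a b := by
  refine h.piece_induction (R := fun s t ↦ (t - s) * k ≤ S.length γ s t) ?_ ?_
  · intro s t u hs hst htu hu hst_le htu_le
    linarith [(h.restrict hs (hst.trans htu) hu).length_add S hst.le htu.le]
  · intro s t hs hst ht _ hP
    rw [← smul_eq_mul, ← intervalIntegral.integral_const]
    refine intervalIntegral.integral_mono_on_of_le_Ioo hst.le (by simp)
      ((h.restrict hs hst ht).intervalIntegrable_speed S) fun τ hτ ↦ ?_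
    exact (hk _ _ (hP τ (Ioo_subset_Icc_self hτ))).trans_eq (S.speed_eq_sqrt_mfderivWithin hτ).symm

theorem IsPiecewiseC1With.length_le (S : SpaceTime n M) {c : M}
    (h : IsPiecewiseC1With P γ a b)
    (hsource : MapsTo γ (Icc a b) (chartAt (EuclideanSpace ℝ (Fin (n + 1))) c).source)
    (l : EuclideanSpace ℝ (Fin (n + 1)) →L[ℝ] ℝ)
    (hl : ∀ t ∈ Icc a b, ∀ V : TangentSpace (𝓡 (n + 1)) (γ t), P (γ t) V →
      √(-S.val (γ t) V V) ≤ l (chartCoord c (γ t) V)) :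
    S.length γ a b ≤ l (extChartAt (𝓡 (n + 1)) c (γ b) - extChartAt (𝓡 (n + 1)) c (γ a)) := by
  rw [map_sub]
  refine h.piece_induction
    (R := fun s t ↦ S.length γ s t ≤ l (extChartAt (𝓡 (n + 1)) c (γ t)) -
      l (extChartAt (𝓡 (n + 1)) c (γ s))) ?_ ?_
  · intro s t u hs hst htu hu hst_le htu_le
    linarith [(h.restrict hs (hst.trans htu) hu).length_add S hst.le htu.le]
  · intro s t hs hst ht hC1 hP
    have hsub : Icc s t ⊆ Icc a b := Icc_subset_Icc hs ht
    have hderiv : ∀ τ ∈ Icc s t, HasDerivWithinAt (fun τ ↦ l (extChartAt (𝓡 (n + 1)) c (γ τ)))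
        (l (chartCoord c (γ τ) (mfderivWithin 𝓘(ℝ, ℝ) (𝓡 (n + 1)) γ (Icc s t) τ (1 : ℝ))))
        (Icc s t) τ := fun τ hτ ↦
      l.hasFDerivAt.comp_hasDerivWithinAt τ (hasDerivWithinAt_extChartAt_comp
        (hC1.mdifferentiableOn one_ne_zero τ hτ) (hsource (hsub hτ)))
    have hint := (h.restrict hs hst ht).intervalIntegrable_speed S
    rw [intervalIntegrable_iff_integrableOn_Icc_of_le hst.le] at hint
    refine intervalIntegral.integral_le_sub_of_hasDeriv_right_of_le hst.le
      (fun τ hτ ↦ (hderiv τ hτ).continuousWithinAt)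
      (fun τ hτ ↦ ((hderiv τ (Ioo_subset_Icc_self hτ)).hasDerivAt
        (Icc_mem_nhds hτ.1 hτ.2)).hasDerivWithinAt) hint fun τ hτ ↦ ?_
    have hτ' := Ioo_subset_Icc_self hτ
    exact (S.speed_eq_sqrt_mfderivWithin hτ).trans_le (hl τ (hsub hτ') _ (hP τ hτ'))

end Length

/-! ### Adapted coordinate balls -/

section Adapted

variable {S : SpaceTime n M} {c p : M} {ε r : ℝ} {w : EuclideanSpace ℝ (Fin (n + 1))}

/-- In the coordinate ball of radius `r`, which fits into the chart at `c`, the metric and the time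
orientation differ from those at the centre by at most `ε`. -/
structure IsAdapted (S : SpaceTime n M) (c : M) (ε r : ℝ) : Prop where
  pos : 0 < r
  subset_target : Metric.ball (extChartAt (𝓡 (n + 1)) c c) r ⊆ (extChartAt (𝓡 (n + 1)) c).target
  abs_val_sub_form_le : ∀ p ∈ chartBall (𝓡 (n + 1)) c r, ∀ V : TangentSpace (𝓡 (n + 1)) p,
    |S.val p V V - S.form c (chartCoord c p V) (chartCoord c p V)| ≤ ε * ‖chartCoord c p V‖ ^ 2
  abs_val_X_sub_form_le : ∀ p ∈ chartBall (𝓡 (n + 1)) c r, ∀ V : TangentSpace (𝓡 (n + 1)) p,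
    |S.val p (S.X p) V - S.form c (S.vec c) (chartCoord c p V)| ≤ ε * ‖chartCoord c p V‖

theorem exists_isAdapted (S : SpaceTime n M) (c : M) (hε : 0 < ε) {W : Set M} (hW : W ∈ 𝓝 c) :
    ∃ r, S.IsAdapted c ε r ∧ chartBall (𝓡 (n + 1)) c r ⊆ W := by
  obtain ⟨r, hr, htarget, hsub⟩ := exists_chartBall_subset (I := 𝓡 (n + 1)) c
    (inter_mem hW (S.eventually_abs_val_sub_form_le c hε))
  exact ⟨r, ⟨hr, htarget, fun p hp V ↦ ((hsub hp).2 V).1, fun p hp V ↦ ((hsub hp).2 V).2⟩,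
    fun p hp ↦ (hsub hp).1⟩

theorem IsAdapted.form_le (h : S.IsAdapted c ε r) (hp : p ∈ chartBall (𝓡 (n + 1)) c r)
    {V : TangentSpace (𝓡 (n + 1)) p} (hV : S.IsFutureDirected V) :
    S.form c (chartCoord c p V) (chartCoord c p V) ≤ ε * ‖chartCoord c p V‖ ^ 2 ∧
      S.form c (S.vec c) (chartCoord c p V) ≤ ε * ‖chartCoord c p V‖ := by
  have hval := (abs_le.1 (h.abs_val_sub_form_le p hp V)).1
  have hX := (abs_le.1 (h.abs_val_X_sub_form_le p hp V)).1
  exact ⟨by linarith [hV.1.2], by linarith [hV.2]⟩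

/-- The coordinate vectors which are future-directed timelike at `c` with a margin of `ε`: in an
adapted ball with this `ε` they are future-directed timelike everywhere. -/
def cone (S : SpaceTime n M) (c : M) (ε : ℝ) : Set (EuclideanSpace ℝ (Fin (n + 1))) :=
  {w | S.form c w w < -(ε * ‖w‖ ^ 2) ∧ S.form c (S.vec c) w < -(ε * ‖w‖)}

theorem isOpen_cone (S : SpaceTime n M) (c : M) (ε : ℝ) : IsOpen (S.cone c ε) := by
  have hform := continuous_bilinForm_apply (S.form c)
  have hself := hform.comp (continuous_id.prodMk continuous_id)
  have hvec := hform.comp ((continuous_const (y := S.vec c)).prodMk continuous_id)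
  exact (isOpen_lt hself (by fun_prop)).inter (isOpen_lt hvec (by fun_prop))

theorem smul_mem_cone {k : ℝ} (hk : 0 < k) (hw : w ∈ S.cone c ε) : k • w ∈ S.cone c ε := by
  obtain ⟨hform, hX⟩ := hw
  constructor
  · simp only [map_smul, LinearMap.smul_apply, smul_eq_mul, norm_smul, Real.norm_eq_abs,
      abs_of_pos hk]
    nlinarith [mul_pos hk hk]
  · simp only [map_smul, smul_eq_mul, norm_smul, Real.norm_eq_abs, abs_of_pos hk]
    nlinarith

theorem eventually_mem_cone (hw : S.form c w w < 0) (hX : S.form c (S.vec c) w < 0) :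
    ∀ᶠ ε in 𝓝[>] (0 : ℝ), w ∈ S.cone c ε := by
  have hw' : ∀ᶠ ε in 𝓝 (0 : ℝ), S.form c w w < -(ε * ‖w‖ ^ 2) :=
    continuousAt_const.eventually_lt (by fun_prop) (by simpa using hw)
  have hX' : ∀ᶠ ε in 𝓝 (0 : ℝ), S.form c (S.vec c) w < -(ε * ‖w‖) :=
    continuousAt_const.eventually_lt (by fun_prop) (by simpa using hX)
  exact nhdsWithin_le_nhds (hw'.and hX')

theorem exists_vec_mem_cone (S : SpaceTime n M) (c : M) : ∃ ε > 0, S.vec c ∈ S.cone c ε := by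
  have hvec := S.form_vec_vec_neg c
  obtain ⟨ε, hvecε, hε⟩ := ((eventually_mem_cone hvec hvec).and self_mem_nhdsWithin).exists
  exact ⟨ε, hε, hvecε⟩

theorem IsAdapted.timelike (h : S.IsAdapted c ε r) (hp : p ∈ chartBall (𝓡 (n + 1)) c r)
    {V : TangentSpace (𝓡 (n + 1)) p} (hV : chartCoord c p V ∈ S.cone c ε) :
    S.IsTimelike V ∧ S.IsFutureDirected V := by
  have hval := (abs_le.1 (h.abs_val_sub_form_le p hp V)).2
  have hX := (abs_le.1 (h.abs_val_X_sub_form_le p hp V)).2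
  have htimelike : S.val p V V < 0 := by linarith [hV.1]
  refine ⟨htimelike, ⟨?_, htimelike.le⟩, by linarith [hV.2]⟩
  rintro rfl
  simp at htimelike

/-- The coordinate straight line `t ↦ e + t w` in the chart at `c`. -/
noncomputable def chartLine (c : M) (e w : EuclideanSpace ℝ (Fin (n + 1))) (t : ℝ) : M :=
  (extChartAt (𝓡 (n + 1)) c).symm (e + t • w)

variable {e : EuclideanSpace ℝ (Fin (n + 1))}

theorem isPiecewiseC1With_chartLine
    (htarget : Metric.ball (extChartAt (𝓡 (n + 1)) c c) r ⊆ (extChartAt (𝓡 (n + 1)) c).target)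
    (hab : a < b) (ha : e + a • w ∈ Metric.ball (extChartAt (𝓡 (n + 1)) c c) r)
    (hb : e + b • w ∈ Metric.ball (extChartAt (𝓡 (n + 1)) c c) r) :
    IsPiecewiseC1With (fun p V ↦ p ∈ chartBall (𝓡 (n + 1)) c r ∧ chartCoord c p V = w)
      (chartLine c e w) a b := by
  have hball := mapsTo_add_smul_of_convex (convex_ball _ _) ha hb
  have hmaps : MapsTo (fun t ↦ e + t • w) (Icc a b) (extChartAt (𝓡 (n + 1)) c).target :=
    hball.mono_right htarget
  have hsmooth : ContDiff ℝ 1 (fun t : ℝ ↦ e + t • w) := by fun_prop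
  have hC1 : ContMDiffOn 𝓘(ℝ, ℝ) (𝓡 (n + 1)) 1 (chartLine c e w) (Icc a b) :=
    (contMDiffOn_extChartAt_symm (I := 𝓡 (n + 1)) (n := 1) c).comp
      hsmooth.contMDiff.contMDiffOn hmaps
  refine ⟨hab, hC1.continuousOn, ∅, fun s t has hst htb _ ↦ ?_⟩
  have hsub : Icc s t ⊆ Icc a b := Icc_subset_Icc has htb
  refine ⟨hC1.mono hsub, fun τ hτ ↦ ⟨?_, ?_⟩⟩
  · exact (symm_mem_chartBall_iff (hmaps (hsub hτ))).2 (hball (hsub hτ))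
  · have hderiv : HasDerivAt (fun t : ℝ ↦ e + t • w) w τ := by
      simpa using ((hasDerivAt_id τ).smul_const w).const_add e
    exact chartCoord_mfderivWithin_symm_comp (η := fun t ↦ e + t • w)
      (uniqueDiffOn_Icc hst τ hτ) hderiv.hasDerivWithinAt hτ (hmaps.mono_left hsub)

theorem IsAdapted.isTimelikeCurve_chartLine (h : S.IsAdapted c ε r) (hab : a < b)
    (ha : e + a • w ∈ Metric.ball (extChartAt (𝓡 (n + 1)) c c) r)
    (hb : e + b • w ∈ Metric.ball (extChartAt (𝓡 (n + 1)) c c) r) (hw : w ∈ S.cone c ε) :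
    S.IsTimelikeCurve (chartLine c e w) a b :=
  (isPiecewiseC1With_chartLine h.subset_target hab ha hb).mono fun _ _ hV ↦
    h.timelike hV.1 (hV.2.symm ▸ hw)

theorem IsAdapted.le_length_chartLine (h : S.IsAdapted c ε r) (hab : a < b)
    (ha : e + a • w ∈ Metric.ball (extChartAt (𝓡 (n + 1)) c c) r)
    (hb : e + b • w ∈ Metric.ball (extChartAt (𝓡 (n + 1)) c c) r) :
    (b - a) * √(-S.form c w w - ε * ‖w‖ ^ 2) ≤ S.length (chartLine c e w) a b := by
  refine (isPiecewiseC1With_chartLine h.subset_target hab ha hb).mul_le_length S ?_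
  rintro p V ⟨hp, rfl⟩
  exact Real.sqrt_le_sqrt (by linarith [(abs_le.1 (h.abs_val_sub_form_le p hp V)).2])

theorem IsAdapted.chron (h : S.IsAdapted c ε r) {e₀ e₁ : EuclideanSpace ℝ (Fin (n + 1))}
    (h₀ : e₀ ∈ Metric.ball (extChartAt (𝓡 (n + 1)) c c) r)
    (h₁ : e₁ ∈ Metric.ball (extChartAt (𝓡 (n + 1)) c c) r) (hw : e₁ - e₀ ∈ S.cone c ε) :
    S.Chron ((extChartAt (𝓡 (n + 1)) c).symm e₀) ((extChartAt (𝓡 (n + 1)) c).symm e₁) :=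
  ⟨_, 0, 1, h.isTimelikeCurve_chartLine one_pos (by simpa using h₀) (by simpa using h₁) hw,
    by simp [chartLine], by simp [chartLine]⟩

theorem exists_length_add_le (S : SpaceTime n M) {G : EuclideanSpace ℝ (Fin (n + 1))}
    (hG : S.form c G G < -1) (hXG : 0 < S.form c (S.vec c) G) {W : Set M} (hW : W ∈ 𝓝 c) :
    ∃ δ > 0, ∃ R, S.IsAdapted c δ R ∧ chartBall (𝓡 (n + 1)) c R ⊆ W ∧
      ∀ γ a b, S.IsCausalCurve γ a b → MapsTo γ (Icc a b) (chartBall (𝓡 (n + 1)) c R) →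
        S.length γ a b +
            δ * ‖extChartAt (𝓡 (n + 1)) c (γ b) - extChartAt (𝓡 (n + 1)) c (γ a)‖ ≤
          S.form c G (extChartAt (𝓡 (n + 1)) c (γ b) - extChartAt (𝓡 (n + 1)) c (γ a)) := by
  obtain ⟨δ, hδ, hsqrt⟩ := (S.isLorentzForm_form c).exists_sqrt_add_le (N := -G)
    (S.form_vec_vec_neg c) (by simpa using hG) (by simpa using hXG)
  simp only [map_neg, LinearMap.neg_apply, neg_neg] at hsqrt
  obtain ⟨R, hR, hRW⟩ := S.exists_isAdapted c hδ hW
  refine ⟨δ, hδ, R, hR, hRW, fun γ a b hγ hmaps ↦ ?_⟩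
  obtain ⟨f, hf, hfΔ⟩ := exists_dual_vector'' ℝ
    (extChartAt (𝓡 (n + 1)) c (γ b) - extChartAt (𝓡 (n + 1)) c (γ a))
  have hlength := IsPiecewiseC1With.length_le S hγ
    (fun t ht ↦ extChartAt_source (𝓡 (n + 1)) c ▸ (hmaps ht).1)
    (LinearMap.toContinuousLinearMap (S.form c G) - δ • f) fun t ht V hV ↦ ?_
  · simp only [FunLike.coe_sub, Pi.sub_apply, LinearMap.coe_toContinuousLinearMap',
      FunLike.coe_smul, Pi.smul_apply, smul_eq_mul, hfΔ, RCLike.ofReal_real_eq_id, id_eq] at hlength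
    linarith
  · obtain ⟨hform, hX⟩ := hR.form_le (hmaps ht) hV
    have hval := (abs_le.1 (hR.abs_val_sub_form_le _ (hmaps ht) V)).1
    have hfV := (le_abs_self _).trans (f.le_of_opNorm_le hf (chartCoord c (γ t) V))
    calc √(-S.val (γ t) V V)
        ≤ √(δ * ‖chartCoord c (γ t) V‖ ^ 2 -
            S.form c (chartCoord c (γ t) V) (chartCoord c (γ t) V)) :=
          Real.sqrt_le_sqrt (by linarith)
      _ ≤ S.form c G (chartCoord c (γ t) V) - δ * ‖chartCoord c (γ t) V‖ :=
          le_sub_iff_add_le.2 (hsqrt _ hform hX)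
      _ ≤ S.form c G (chartCoord c (γ t) V) - δ * f (chartCoord c (γ t) V) := by
          gcongr; linarith

theorem exists_length_le (S : SpaceTime n M) (c : M) {W : Set M} (hW : W ∈ 𝓝 c) :
    ∃ R > 0, ∃ C, Metric.ball (extChartAt (𝓡 (n + 1)) c c) R ⊆ (extChartAt (𝓡 (n + 1)) c).target ∧
      chartBall (𝓡 (n + 1)) c R ⊆ W ∧ ∀ γ a b, S.IsCausalCurve γ a b →
        MapsTo γ (Icc a b) (chartBall (𝓡 (n + 1)) c R) → S.length γ a b ≤ C := by
  obtain ⟨k, hk, hk_lt⟩ : ∃ k : ℝ, 0 < k ∧ S.form c (-k • S.vec c) (-k • S.vec c) < -1 := by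
    have hvec := S.form_vec_vec_neg c
    have hinv := inv_lt_zero.2 hvec
    refine ⟨1 - (S.form c (S.vec c) (S.vec c))⁻¹, by linarith, ?_⟩
    simp only [map_smul, LinearMap.smul_apply, smul_eq_mul]
    linear_combination hvec + hinv +
      ((S.form c (S.vec c) (S.vec c))⁻¹ - 2) * mul_inv_cancel₀ hvec.ne
  obtain ⟨δ, hδ, R, hR, hRW, hlength⟩ := S.exists_length_add_le hk_lt
    (by simpa using mul_neg_of_pos_of_neg hk (S.form_vec_vec_neg c)) hW
  refine ⟨R, hR.pos, ‖LinearMap.toContinuousLinearMap (S.form c (-k • S.vec c))‖ * (R + R),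
    hR.subset_target, hRW, fun γ a b hγ hmaps ↦ ?_⟩
  have hdist : ‖extChartAt (𝓡 (n + 1)) c (γ b) - extChartAt (𝓡 (n + 1)) c (γ a)‖ ≤ R + R := by
    have hγa := (hmaps (left_mem_Icc.2 hγ.1.le)).2
    have hγb := (hmaps (right_mem_Icc.2 hγ.1.le)).2
    rw [← dist_eq_norm]
    exact (dist_triangle_right _ _ _).trans (add_le_add hγb.le hγa.le)
  have hΔ := (le_abs_self _).trans
    ((LinearMap.toContinuousLinearMap (S.form c (-k • S.vec c))).le_opNorm_of_le hdist)
  have hle := hlength γ a b hγ hmaps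
  have hnonneg := mul_nonneg hδ.le
    (norm_nonneg (extChartAt (𝓡 (n + 1)) c (γ b) - extChartAt (𝓡 (n + 1)) c (γ a)))
  rw [LinearMap.coe_toContinuousLinearMap'] at hΔ
  linarith

end Adapted

end SpaceTime

/-! ### Openness of the chronological relation -/

theorem exists_forall_add_smul_mem_ball_diff {E : Type*} [NormedAddCommGroup E] [NormedSpace ℝ E]
    {v : E} (hv : v ≠ 0) (x : E) {R : ℝ} (hR : 0 < R) :
    ∃ t : ℝ, 0 < t ∧
      ∀ e ∈ Metric.ball x (R / 4), e + t • v ∈ Metric.ball x R \ Metric.ball x (R / 4) := by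
  have hv' : 0 < ‖v‖ := norm_pos_iff.2 hv
  refine ⟨R / 2 / ‖v‖, by positivity, fun e he ↦ ?_⟩
  have hnorm : ‖(R / 2 / ‖v‖) • v‖ = R / 2 := by
    rw [norm_smul, Real.norm_of_nonneg (by positivity), div_mul_cancel₀ _ hv'.ne']
  rw [mem_ball_iff_norm] at he
  rw [Set.mem_sdiff, mem_ball_iff_norm, mem_ball_iff_norm, add_sub_right_comm]
  have hle := norm_add_le (e - x) ((R / 2 / ‖v‖) • v)
  have hge := norm_le_add_norm_add ((R / 2 / ‖v‖) • v) (e - x)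
  rw [add_comm _ (e - x)] at hge
  constructor <;> linarith

namespace SpaceTime

variable {n : ℕ} {M : Type*} [TopologicalSpace M] [ChartedSpace (EuclideanSpace ℝ (Fin (n + 1))) M]

theorem IsPiecewiseC1With.exists_last_piece {P : ∀ x : M, TangentSpace (𝓡 (n + 1)) x → Prop}
    {γ : ℝ → M} {a b : ℝ} (h : IsPiecewiseC1With P γ a b) :
    ∃ c < b, ContMDiffOn 𝓘(ℝ, ℝ) (𝓡 (n + 1)) 1 γ (Icc c b) ∧
      ∀ t ∈ Icc c b, P (γ t) (mfderivWithin 𝓘(ℝ, ℝ) (𝓡 (n + 1)) γ (Icc c b) t (1 : ℝ)) :=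
  h.piece_induction (R := fun _ b ↦ ∃ c < b, ContMDiffOn 𝓘(ℝ, ℝ) (𝓡 (n + 1)) 1 γ (Icc c b) ∧
      ∀ t ∈ Icc c b, P (γ t) (mfderivWithin 𝓘(ℝ, ℝ) (𝓡 (n + 1)) γ (Icc c b) t (1 : ℝ)))
    (fun _ _ _ _ _ _ _ _ h ↦ h) fun c _ _ hcd _ hC1 hP ↦ ⟨c, hcd, hC1, hP⟩

section Openness

variable [IsManifold (𝓡 (n + 1)) ∞ M] (S : SpaceTime n M)

theorem IsTimelikeCurve.exists_eventually_sub_mem_cone {S : SpaceTime n M} {γ : ℝ → M} {a b : ℝ}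
    (h : S.IsTimelikeCurve γ a b) :
    ∃ ε > 0, ∀ᶠ t in 𝓝[<] b,
      extChartAt (𝓡 (n + 1)) (γ b) (γ b) - extChartAt (𝓡 (n + 1)) (γ b) (γ t) ∈
        S.cone (γ b) ε := by
  obtain ⟨c, hcb, hC1, hP⟩ := IsPiecewiseC1With.exists_last_piece h
  have hb : b ∈ Icc c b := right_mem_Icc.2 hcb.le
  have hderiv : HasDerivWithinAt (fun t ↦ extChartAt (𝓡 (n + 1)) (γ b) (γ t))
      (mfderivWithin 𝓘(ℝ, ℝ) (𝓡 (n + 1)) γ (Icc c b) b (1 : ℝ) : EuclideanSpace ℝ (Fin (n + 1)))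
      (Icc c b) b := by
    simpa only [chartCoord_self] using hasDerivWithinAt_extChartAt_comp
      (hC1.mdifferentiableOn one_ne_zero b hb) (mem_chart_source _ (γ b))
  have hslope := hasDerivWithinAt_iff_tendsto_slope.1 hderiv
  rw [Icc_sdiff_right, nhdsWithin_Ico_eq_nhdsLT hcb] at hslope
  obtain ⟨ε, hcone, hε⟩ :=
    ((eventually_mem_cone (hP b hb).1 (hP b hb).2.2).and self_mem_nhdsWithin).exists
  refine ⟨ε, hε, ?_⟩
  filter_upwards [hslope.eventually ((S.isOpen_cone _ ε).mem_nhds hcone), self_mem_nhdsWithin]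
    with t hcone_t ht
  have htb : 0 < b - t := sub_pos.2 ht
  convert smul_mem_cone htb hcone_t using 1
  rw [slope_comm, slope_def_module, smul_inv_smul₀ htb.ne']

theorem isOpen_chronFuture (p : M) : IsOpen {q | S.Chron p q} := by
  rw [isOpen_iff_mem_nhds]
  rintro _ ⟨γ, a, b, hγ, rfl, rfl⟩
  obtain ⟨ε, hε, hcone⟩ := hγ.exists_eventually_sub_mem_cone
  obtain ⟨r, hr, -⟩ := S.exists_isAdapted (γ b) hε univ_mem
  have hball := chartBall_mem_nhds (𝓡 (n + 1)) (γ b) hr.pos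
  have hcont : Tendsto γ (𝓝[<] b) (𝓝 (γ b)) :=
    (hγ.2.1 b (right_mem_Icc.2 hγ.1.le)).mono_left (nhdsWithin_le_of_mem (Icc_mem_nhdsLT hγ.1))
  obtain ⟨t, ⟨htcone, htball⟩, hat, htb⟩ :=
    ((hcone.and (hcont.eventually hball)).and (Ioo_mem_nhdsLT hγ.1)).exists
  filter_upwards [hball, ((continuousAt_extChartAt (I := 𝓡 (n + 1)) (γ b)).sub
    continuousAt_const).preimage_mem_nhds ((S.isOpen_cone _ ε).mem_nhds htcone)] with q hq hqcone
  have hchron := hr.chron htball.2 hq.2 hqcone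
  rw [(extChartAt _ (γ b)).left_inv htball.1, (extChartAt _ (γ b)).left_inv hq.1] at hchron
  exact Chron.trans ⟨γ, a, t, hγ.restrict le_rfl hat htb.le, rfl, rfl⟩ hchron

theorem isOpen_chronPast_singleton (p : M) : IsOpen {q | S.Chron q p} := by
  simpa only [chron_rev_iff] using S.rev.isOpen_chronFuture p

theorem isOpen_chronPast (A : Set M) : IsOpen (S.chronPast A) := by
  have hA : S.chronPast A = ⋃ p ∈ A, {q | S.Chron q p} := by
    ext q
    simp only [chronPast, mem_ofPred_eq, mem_iUnion, exists_prop]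
  exact hA ▸ isOpen_biUnion fun p _ ↦ S.isOpen_chronPast_singleton p

theorem exists_chron_mem (p : M) {W : Set M} (hW : W ∈ 𝓝 p) : ∃ q ∈ W, S.Chron p q := by
  obtain ⟨ε, hε, hvec⟩ := S.exists_vec_mem_cone p
  obtain ⟨r, hr, hrW⟩ := S.exists_isAdapted p hε hW
  have hcont : Continuous (fun t : ℝ ↦ extChartAt (𝓡 (n + 1)) p p + t • S.vec p) := by fun_prop
  have hball : ∀ᶠ t in 𝓝[>] (0 : ℝ), extChartAt (𝓡 (n + 1)) p p + t • S.vec p ∈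
      Metric.ball (extChartAt (𝓡 (n + 1)) p p) r :=
    nhdsWithin_le_nhds (hcont.continuousAt.preimage_mem_nhds
      (by simpa using Metric.ball_mem_nhds _ hr.pos))
  obtain ⟨t, ht, ht0⟩ := (hball.and self_mem_nhdsWithin).exists
  refine ⟨_, hrW ((symm_mem_chartBall_iff (hr.subset_target ht)).2 ht), ?_⟩
  have hchron := hr.chron (Metric.mem_ball_self hr.pos) ht
    (by rw [add_sub_cancel_left]; exact smul_mem_cone ht0 hvec)
  rwa [extChartAt_to_inv] at hchron

theorem exists_chron_mem_past (p : M) {W : Set M} (hW : W ∈ 𝓝 p) : ∃ q ∈ W, S.Chron q p := by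
  simpa only [chron_rev_iff] using S.rev.exists_chron_mem p hW

theorem exists_isOpen_forall_exists_chron_notMem (c : M) :
    ∃ U : Set M, IsOpen U ∧ c ∈ U ∧ ∀ p ∈ U, ∃ q ∉ U, S.Chron p q := by
  obtain ⟨ε, hε, hvec⟩ := S.exists_vec_mem_cone c
  obtain ⟨R, hR, -⟩ := S.exists_isAdapted c hε univ_mem
  have hvec0 : S.vec c ≠ 0 := by
    intro h
    simpa [h] using S.form_vec_vec_neg c
  obtain ⟨t, ht, htball⟩ :=
    exists_forall_add_smul_mem_ball_diff hvec0 (extChartAt (𝓡 (n + 1)) c c) hR.pos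
  have hR4 := div_pos hR.pos four_pos
  refine ⟨chartBall (𝓡 (n + 1)) c (R / 4), isOpen_chartBall _ _ _,
    mem_of_mem_nhds (chartBall_mem_nhds _ c hR4), fun p hp ↦ ?_⟩
  obtain ⟨hmem, hnotMem⟩ := htball _ hp.2
  refine ⟨(extChartAt (𝓡 (n + 1)) c).symm (extChartAt (𝓡 (n + 1)) c p + t • S.vec c),
    fun h ↦ hnotMem ((symm_mem_chartBall_iff (hR.subset_target hmem)).1 h), ?_⟩
  have hchron := hR.chron (Metric.ball_subset_ball (by linarith [hR.pos]) hp.2) hmem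
    (by rw [add_sub_cancel_left]; exact smul_mem_cone ht hvec)
  rwa [(extChartAt _ c).left_inv hp.1] at hchron

end Openness

end SpaceTime

/-! ### Inextendible curves -/

theorem exists_seq_rel_not_tendsto {M : Type*} [TopologicalSpace M] [SecondCountableTopology M]
    {R : M → M → Prop} {A : Set M}
    (hA : ∀ c : M, ∃ U : Set M, IsOpen U ∧ c ∈ U ∧ ∀ p ∈ A, p ∈ U → ∃ q ∈ A, q ∉ U ∧ R p q)
    {p₀ : M} (hp₀ : p₀ ∈ A) :
    ∃ p : ℕ → M, p 0 = p₀ ∧ (∀ i, p i ∈ A) ∧ (∀ i, R (p i) (p (i + 1))) ∧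
      ¬ ∃ q, Tendsto p atTop (𝓝 q) := by
  choose U hUo hUc hU using hA
  obtain ⟨s, hs, hsU⟩ := TopologicalSpace.countable_cover_nhds fun c ↦ (hUo c).mem_nhds (hUc c)
  have hcover : ∀ q, ∃ c ∈ s, q ∈ U c := fun q ↦ by
    simpa only [mem_iUnion, exists_prop] using hsU.symm.subset (mem_univ q)
  obtain ⟨f, hf⟩ := hs.exists_eq_range ((hcover p₀).imp fun _ hc ↦ hc.1)
  have hstep : ∀ (c : M) (p : A), ∃ q : A, R p q ∧ ((p : M) ∈ U c → (q : M) ∉ U c) := by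
    intro c p
    by_cases hp : (p : M) ∈ U c
    · obtain ⟨q, hq, hqU, hpq⟩ := hU c p p.2 hp
      exact ⟨⟨q, hq⟩, hpq, fun _ ↦ hqU⟩
    · obtain ⟨q, hq, -, hpq⟩ := hU p p p.2 (hUc p)
      exact ⟨⟨q, hq⟩, hpq, fun h ↦ absurd h hp⟩
  choose next hR hnext using hstep
  -- The first component of `Nat.unpair` makes the sequence leave each `U (f j)` infinitely often.
  let p : ℕ → A := fun i ↦ Nat.rec ⟨p₀, hp₀⟩ (fun i p ↦ next (f i.unpair.1) p) i
  refine ⟨fun i ↦ (p i).1, rfl, fun i ↦ (p i).2, fun i ↦ hR (f i.unpair.1) (p i), ?_⟩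
  rintro ⟨q, hq⟩
  obtain ⟨c, hc, hqc⟩ := hcover q
  obtain ⟨j, rfl⟩ := hf ▸ hc
  obtain ⟨N, hN⟩ := eventually_atTop.1 (hq.eventually ((hUo (f j)).mem_nhds hqc))
  have hleave := hnext (f (Nat.pair j N).unpair.1) (p (Nat.pair j N))
  rw [Nat.unpair_pair] at hleave
  refine hleave (hN _ (Nat.right_le_pair j N)) ?_
  have hstay := hN (Nat.pair j N + 1) ((Nat.right_le_pair j N).trans (Nat.le_succ _))
  change (next (f (Nat.pair j N).unpair.1) (p (Nat.pair j N)) : M) ∈ U (f j) at hstay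
  rwa [Nat.unpair_pair] at hstay

theorem exists_int_seq_of_nat_seqs {M : Type*} {R : M → M → Prop} {p q : ℕ → M} (h₀ : p 0 = q 0)
    (hp : ∀ i, R (p i) (p (i + 1))) (hq : ∀ i, R (q (i + 1)) (q i)) :
    ∃ z : ℤ → M, (∀ i, R (z i) (z (i + 1))) ∧ (∀ i : ℕ, z i = p i) ∧ ∀ i : ℕ, z (-i) = q i := by
  let z : ℤ → M := fun
    | .ofNat i => p i
    | .negSucc i => q (i + 1)
  have hneg : ∀ i : ℕ, z (-i) = q i
    | 0 => h₀
    | _ + 1 => rfl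
  refine ⟨z, ?_, fun _ ↦ rfl, hneg⟩
  rintro (i | i)
  · exact hp i
  · rw [show Int.negSucc i + 1 = -(i : ℤ) by rw [Int.negSucc_eq]; ring, hneg]
    exact hq i

namespace SpaceTime

variable {n : ℕ} {M : Type*} [TopologicalSpace M] [ChartedSpace (EuclideanSpace ℝ (Fin (n + 1))) M]

section Concatenation

variable {P : ∀ x : M, TangentSpace (𝓡 (n + 1)) x → Prop}

theorem isPiecewiseC1With_of_forall_int {γ : ℝ → M}
    (h : ∀ i : ℤ, IsPiecewiseC1With P γ i (i + 1)) {a b : ℝ} (hab : a < b) :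
    IsPiecewiseC1With P γ a b := by
  have hlong : ∀ (i : ℤ) (k : ℕ), IsPiecewiseC1With P γ i (i + (k + 1 : ℕ)) := by
    intro i k
    induction k with
    | zero => simpa using h i
    | succ k ih =>
      have hnext := h (i + (k + 1 : ℕ))
      rw [Int.cast_add, Int.cast_natCast] at hnext
      rw [Nat.cast_add_one (k + 1), ← add_assoc]
      exact ih.trans hnext
  obtain ⟨k, hk⟩ := exists_nat_gt (b - ⌊a⌋)
  refine (hlong ⌊a⌋ k).restrict (Int.floor_le a) hab ?_
  push_cast
  linarith

theorem exists_forall_isPiecewiseC1With_of_joinedBy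
    (hP : ∀ x V, ∀ k : ℝ, 0 < k → P x V → P x (k • V)) {p : ℤ → M}
    (hp : ∀ i, JoinedBy P (p i) (p (i + 1))) :
    ∃ γ : ℝ → M, (∀ a b : ℝ, a < b → IsPiecewiseC1With P γ a b) ∧ ∀ i : ℤ, γ i = p i := by
  have hunit : ∀ i : ℤ, ∃ σ : ℝ → M, IsPiecewiseC1With P σ i (i + 1) ∧ σ i = p i ∧
      σ (i + 1) = p (i + 1) := by
    intro i
    obtain ⟨γ, a, b, h, ha, hb⟩ := hp i
    obtain ⟨σ, hσ, hleft, hright⟩ := h.exists_unit_interval hP i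
    exact ⟨σ, hσ, hleft.trans ha, hright.trans hb⟩
  choose σ hσ hleft hright using hunit
  let γ : ℝ → M := fun t ↦ σ ⌊t⌋ t
  have hγ : ∀ i : ℤ, γ i = p i := fun i ↦ by simp only [γ, Int.floor_intCast, hleft]
  refine ⟨γ, fun a b hab ↦ isPiecewiseC1With_of_forall_int (fun i ↦ ?_) hab, hγ⟩
  refine (hσ i).congr fun t ht ↦ ?_
  rcases ht.2.eq_or_lt with rfl | hlt
  · exact_mod_cast (hγ (i + 1)).trans (hright i).symm
  · simp only [γ, Int.floor_eq_iff.2 ⟨ht.1, hlt⟩]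

end Concatenation

variable [IsManifold (𝓡 (n + 1)) ∞ M]

section Chains

variable [SecondCountableTopology M]

theorem exists_chron_seq_not_tendsto (S : SpaceTime n M) (p₀ : M) :
    ∃ p : ℕ → M, p 0 = p₀ ∧ (∀ i, S.Chron (p i) (p (i + 1))) ∧ ¬ ∃ q, Tendsto p atTop (𝓝 q) := by
  have hleave : ∀ c : M, ∃ U : Set M, IsOpen U ∧ c ∈ U ∧
      ∀ p ∈ univ, p ∈ U → ∃ q ∈ univ, q ∉ U ∧ S.Chron p q := by
    simpa only [mem_univ, true_and, true_implies] using
      S.exists_isOpen_forall_exists_chron_notMem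
  obtain ⟨p, hp₀, -, hp, hlim⟩ := exists_seq_rel_not_tendsto hleave (mem_univ p₀)
  exact ⟨p, hp₀, hp, hlim⟩

theorem exists_chron_seq_not_tendsto_past (S : SpaceTime n M) (p₀ : M) :
    ∃ p : ℕ → M, p 0 = p₀ ∧ (∀ i, S.Chron (p (i + 1)) (p i)) ∧ ¬ ∃ q, Tendsto p atTop (𝓝 q) := by
  simpa only [chron_rev_iff] using S.rev.exists_chron_seq_not_tendsto p₀

end Chains

theorem exists_isInextendibleCausalCurve {S : SpaceTime n M}
    {P : ∀ x : M, TangentSpace (𝓡 (n + 1)) x → Prop}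
    (hPS : ∀ x V, P x V → S.IsFutureDirected V)
    (hP : ∀ x V, ∀ k : ℝ, 0 < k → P x V → P x (k • V)) {p q : ℕ → M} (h₀ : p 0 = q 0)
    (hp : ∀ i, JoinedBy P (p i) (p (i + 1))) (hq : ∀ i, JoinedBy P (q (i + 1)) (q i))
    (hp_lim : ¬ ∃ x, Tendsto p atTop (𝓝 x)) (hq_lim : ¬ ∃ x, Tendsto q atTop (𝓝 x)) :
    ∃ γ : ℝ → M, S.IsInextendibleCausalCurve γ ∧
      (∀ a b : ℝ, a < b → IsPiecewiseC1With P γ a b) ∧ ∀ i : ℕ, γ i = p i := by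
  obtain ⟨z, hz, hzp, hzq⟩ := exists_int_seq_of_nat_seqs h₀ hp hq
  obtain ⟨γ, hγ, hγz⟩ := exists_forall_isPiecewiseC1With_of_joinedBy hP hz
  have hγp : ∀ i : ℕ, γ i = p i := fun i ↦ by exact_mod_cast (hγz i).trans (hzp i)
  have hγq : ∀ i : ℕ, γ (-i) = q i := fun i ↦ by exact_mod_cast (hγz (-i)).trans (hzq i)
  refine ⟨γ, ⟨fun a b hab ↦ (hγ a b hab).mono hPS, fun ⟨x, hx⟩ ↦ hp_lim ⟨x, ?_⟩,
    fun ⟨x, hx⟩ ↦ hq_lim ⟨x, ?_⟩⟩, hγ, hγp⟩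
  · exact (hx.comp tendsto_natCast_atTop_atTop).congr hγp
  · exact (hx.comp (tendsto_neg_atTop_atBot.comp tendsto_natCast_atTop_atTop)).congr hγq

/-! ### Cauchy surfaces -/

section CauchySurface

variable {S : SpaceTime n M} {Γ : Set M} [SecondCountableTopology M]

theorem IsCauchySurface.not_causLt (hΓ : S.IsCauchySurface Γ) {y z : M} (hy : y ∈ Γ)
    (hz : z ∈ Γ) : ¬ S.CausLt y z := by
  intro hyz
  obtain ⟨p, hp₀, hp, hp_lim⟩ := S.exists_chron_seq_not_tendsto z
  obtain ⟨q, hq₀, hq, hq_lim⟩ := S.exists_chron_seq_not_tendsto_past y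
  let p' : ℕ → M := fun i ↦ Nat.casesOn i y p
  have hp' : ∀ i, S.CausLt (p' i) (p' (i + 1))
    | 0 => show S.CausLt y (p 0) from hp₀.symm ▸ hyz
    | i + 1 => (hp i).causLt
  have hp'_lim : ¬ ∃ x, Tendsto p' atTop (𝓝 x) := fun ⟨x, hx⟩ ↦
    hp_lim ⟨x, hx.comp (tendsto_add_atTop_nat 1)⟩
  obtain ⟨γ, hγ, -, hγp⟩ := exists_isInextendibleCausalCurve (S := S) (fun _ _ h ↦ h)
    (fun _ _ _ hk hV ↦ hV.smul hk) hq₀.symm hp' (fun i ↦ (hq i).causLt) hp'_lim hq_lim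
  have hγ₀ : γ (0 : ℕ) ∈ Γ := (hγp 0).symm ▸ hy
  have hγ₁ : γ (1 : ℕ) ∈ Γ := ((hγp 1).trans hp₀).symm ▸ hz
  exact zero_ne_one (Nat.cast_injective ((hΓ γ hγ).unique hγ₀ hγ₁))

theorem IsCauchySurface.trichotomy (hΓ : S.IsCauchySurface Γ) (x : M) :
    x ∈ Γ ∨ (∃ y ∈ Γ, S.Chron x y) ∨ ∃ y ∈ Γ, S.Chron y x := by
  obtain ⟨p, hp₀, hp, hp_lim⟩ := S.exists_chron_seq_not_tendsto x
  obtain ⟨q, hq₀, hq, hq_lim⟩ := S.exists_chron_seq_not_tendsto_past x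
  obtain ⟨γ, hγ, hγ_timelike, hγp⟩ := exists_isInextendibleCausalCurve (S := S)
    (fun _ _ h ↦ h.2) (fun _ _ _ hk hV ↦ ⟨hV.1.smul hk, hV.2.smul hk⟩) (hp₀.trans hq₀.symm)
    hp hq hp_lim hq_lim
  have hγ₀ : γ 0 = x := by exact_mod_cast (hγp 0).trans hp₀
  obtain ⟨t, ht, -⟩ := hΓ γ hγ
  rcases lt_trichotomy t 0 with hneg | rfl | hpos
  · exact Or.inr (Or.inr ⟨γ t, ht, γ, t, 0, hγ_timelike t 0 hneg, rfl, hγ₀⟩)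
  · exact Or.inl (hγ₀ ▸ ht)
  · exact Or.inr (Or.inl ⟨γ t, ht, γ, 0, t, hγ_timelike 0 t hpos, hγ₀, rfl⟩)

theorem IsCauchySurface.isClosed (hΓ : S.IsCauchySurface Γ) : IsClosed Γ := by
  rw [← isOpen_compl_iff, isOpen_iff_mem_nhds]
  intro x hx
  rcases (hΓ.trichotomy x).resolve_left hx with ⟨y, hy, hxy⟩ | ⟨y, hy, hyx⟩
  · filter_upwards [(S.isOpen_chronPast_singleton y).mem_nhds hxy] with z hz hzΓ
    exact hΓ.not_causLt hzΓ hy (Chron.causLt hz)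
  · filter_upwards [(S.isOpen_chronFuture y).mem_nhds hyx] with z hz hzΓ
    exact hΓ.not_causLt hy hzΓ (Chron.causLt hz)

end CauchySurface

/-! ### Closedness of the causal relation -/

theorem caus_of_tendsto {S : SpaceTime n M} [T2Space M]
    (hS : ∀ p q, IsCompact (S.causalFuture p ∩ S.causalPast q)) {ι : Type*} {l : Filter ι}
    [l.NeBot] {p q : ι → M} {p₀ q₀ : M} (hp : Tendsto p l (𝓝 p₀)) (hq : Tendsto q l (𝓝 q₀))
    (hpq : ∀ᶠ i in l, S.Caus (p i) (q i)) : S.Caus p₀ q₀ := by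
  obtain ⟨q', -, hq'⟩ := S.exists_chron_mem q₀ univ_mem
  obtain ⟨p', -, hp'⟩ := S.exists_chron_mem_past p₀ univ_mem
  have hpast : ∀ z, S.Chron z p₀ → S.Caus z q₀ := by
    intro z hz
    refine ((hS z q').isClosed.mem_of_tendsto hq ?_).1
    filter_upwards [hpq, hp.eventually ((S.isOpen_chronFuture z).mem_nhds hz),
      hq.eventually ((S.isOpen_chronPast_singleton q').mem_nhds hq')] with i hi hzi hiq'
    exact ⟨Or.inr (hzi.causLt.trans_caus hi), Or.inr hiq'.causLt⟩
  have hp₀ : p₀ ∈ closure (S.causalFuture p' ∩ S.causalPast q₀) := by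
    rw [mem_closure_iff_nhds]
    intro W hW
    obtain ⟨z, ⟨hzW, hp'z⟩, hz⟩ := S.exists_chron_mem_past p₀
      (inter_mem hW ((S.isOpen_chronFuture p').mem_nhds hp'))
    exact ⟨z, hzW, Or.inr (Chron.causLt hp'z), hpast z hz⟩
  rw [(hS p' q₀).isClosed.closure_eq] at hp₀
  exact hp₀.2

end SpaceTime

/-! ### Boundedness of the cost of causal curves to a Cauchy surface -/

theorem exists_mem_frontier_of_not_mapsTo {M : Type*} [TopologicalSpace M] {U : Set M}
    (hU : IsOpen U) {γ : ℝ → M} {a b : ℝ} (hγ : ContinuousOn γ (Icc a b)) (ha : γ a ∈ U)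
    (hmaps : ¬ MapsTo γ (Icc a b) U) :
    ∃ τ ∈ Ioc a b, MapsTo γ (Icc a τ) (closure U) ∧ γ τ ∈ frontier U := by
  have hcompact : IsCompact (Icc a b ∩ γ ⁻¹' Uᶜ) := isCompact_Icc.of_isClosed_subset
    (hγ.preimage_isClosed_of_isClosed isClosed_Icc hU.isClosed_compl) inter_subset_left
  obtain ⟨t, ht, htU⟩ : ∃ t ∈ Icc a b, γ t ∉ U := by
    simpa only [MapsTo, not_forall, exists_prop] using hmaps
  obtain ⟨τ, ⟨hτ, hτU⟩, hτ_le⟩ := hcompact.exists_isLeast ⟨t, ht, htU⟩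
  have haτ : a < τ := hτ.1.lt_of_ne (by rintro rfl; exact hτU ha)
  have hbefore : MapsTo γ (Ico a τ) U := fun t ht ↦ by
    by_contra htU
    exact (hτ_le ⟨⟨ht.1, ht.2.le.trans hτ.2⟩, htU⟩).not_gt ht.2
  have hclosure : MapsTo γ (Icc a τ) (closure U) := by
    rw [← closure_Ico haτ.ne]
    refine hbefore.closure_of_continuousOn ?_
    rw [closure_Ico haτ.ne]
    exact hγ.mono (Icc_subset_Icc_right hτ.2)
  refine ⟨τ, ⟨haτ, hτ.2⟩, hclosure, ?_⟩
  rw [hU.frontier_eq]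
  exact ⟨hclosure (right_mem_Icc.2 haτ.le), hτU⟩

theorem exists_forall_le_of_isClosed {M : Type*} [TopologicalSpace M] {Γ : Set M}
    (hΓ : IsClosed Γ) {φ : Γ → ℝ} (hφ : ∀ y : Γ, (𝓝 y).IsBoundedUnder (· ≥ ·) φ) (c : M) :
    ∃ W ∈ 𝓝 c, ∃ K : ℝ, ∀ y : Γ, (y : M) ∈ W → K ≤ φ y := by
  by_cases hc : c ∈ Γ
  · obtain ⟨K, hK⟩ := hφ ⟨c, hc⟩
    rw [eventually_map, nhds_subtype_eq_comap, eventually_comap] at hK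
    exact ⟨_, hK, K, fun y hy ↦ hy y rfl⟩
  · exact ⟨Γᶜ, hΓ.isOpen_compl.mem_nhds hc, 0, fun y hy ↦ absurd y.2 hy⟩

namespace SpaceTime

variable {n : ℕ} {M : Type*} [TopologicalSpace M] [ChartedSpace (EuclideanSpace ℝ (Fin (n + 1))) M]
  [IsManifold (𝓡 (n + 1)) ∞ M]

/-- The points from which some causal curve to `Γ` has length minus final cost larger than `N`. -/
def largeCost (S : SpaceTime n M) (Γ : Set M) (φ : Γ → ℝ) (N : ℝ) : Set M :=
  {p | ∃ (y : Γ) (γ : ℝ → M) (a b : ℝ), S.IsCausalCurve γ a b ∧ γ a = p ∧ γ b = y ∧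
    N < S.length γ a b - φ y}

/-- The points in whose neighbourhoods length minus final cost is unbounded above on causal curves
to `Γ`. -/
def costBlowUp (S : SpaceTime n M) (Γ : Set M) (φ : Γ → ℝ) : Set M :=
  ⋂ N : ℝ, closure (S.largeCost Γ φ N)

variable {S : SpaceTime n M} {Γ : Set M} {φ : Γ → ℝ}

theorem largeCost_anti : Antitone (S.largeCost Γ φ) := by
  rintro N N' h p ⟨y, γ, a, b, hγ, ha, hb, hN⟩
  exact ⟨y, γ, a, b, hγ, ha, hb, h.trans_lt hN⟩

theorem exists_mem_frontier_mem_largeCost {U B : Set M} (hU : IsOpen U) (hUB : closure U ⊆ B)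
    {C K N : ℝ}
    (hC : ∀ γ a b, S.IsCausalCurve γ a b → MapsTo γ (Icc a b) B → S.length γ a b ≤ C)
    (hK : ∀ y : Γ, (y : M) ∈ B → K ≤ φ y) (hN : C - K ≤ N) {p : M} (hpU : p ∈ U)
    (hp : p ∈ S.largeCost Γ φ N) :
    ∃ q ∈ frontier U, S.Caus p q ∧ q ∈ S.largeCost Γ φ (N - C) := by
  obtain ⟨y, γ, a, b, hγ, rfl, hb, hlength⟩ := hp
  have hleave : ¬ MapsTo γ (Icc a b) B := fun hmaps ↦ by
    linarith [hC γ a b hγ hmaps, hK y (hb ▸ hmaps (right_mem_Icc.2 hγ.1.le))]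
  obtain ⟨τ, hτ, hmaps, hfrontier⟩ := exists_mem_frontier_of_not_mapsTo hU hγ.2.1 hpU
    fun h ↦ hleave (h.mono_right (subset_closure.trans hUB))
  have hmaps' : MapsTo γ (Icc a τ) B := hmaps.mono_right hUB
  have hτb : τ < b := hτ.2.lt_of_ne (by rintro rfl; exact hleave hmaps')
  have hγτ : S.IsCausalCurve γ a τ := hγ.restrict le_rfl hτ.1 hτ.2
  refine ⟨γ τ, hfrontier, Or.inr ⟨γ, a, τ, hγτ, rfl, rfl⟩, y, γ, τ, b,
    hγ.restrict hτ.1.le hτb le_rfl, rfl, hb, ?_⟩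
  linarith [hC γ a τ hγτ hmaps', IsPiecewiseC1With.length_add S hγ hτ.1.le hτ.2]

theorem exists_mem_costBlowUp_notMem [T2Space M] [FirstCountableTopology M]
    (hS : ∀ p q, IsCompact (S.causalFuture p ∩ S.causalPast q)) {U B : Set M} (hU : IsOpen U)
    (hUB : closure U ⊆ B) (hcompact : IsCompact (closure U)) {C K : ℝ}
    (hC : ∀ γ a b, S.IsCausalCurve γ a b → MapsTo γ (Icc a b) B → S.length γ a b ≤ C)
    (hK : ∀ y : Γ, (y : M) ∈ B → K ≤ φ y) {p : M} (hp : p ∈ S.costBlowUp Γ φ) (hpU : p ∈ U) :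
    ∃ q ∈ S.costBlowUp Γ φ, q ∉ U ∧ S.CausLt p q := by
  obtain ⟨V, hV⟩ := (𝓝 p).exists_antitone_basis
  have hnear (i : ℕ) : ∃ z ∈ V i ∩ U, z ∈ S.largeCost Γ φ (C - K + i) :=
    mem_closure_iff_nhds.1 (mem_iInter.1 hp _) _ (inter_mem (hV.mem i) (hU.mem_nhds hpU))
  choose z hzVU hz using hnear
  have hz_lim : Tendsto z atTop (𝓝 p) := hV.tendsto fun i ↦ (hzVU i).1
  choose q hq hzq hq_cost using fun i ↦ exists_mem_frontier_mem_largeCost hU hUB hC hK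
    (le_add_of_nonneg_right i.cast_nonneg) (hzVU i).2 (hz i)
  obtain ⟨q₀, hq₀, f, hf, hq_lim⟩ :=
    (hcompact.of_isClosed_subset isClosed_frontier frontier_subset_closure).tendsto_subseq hq
  have hq₀U : q₀ ∉ U := by
    rw [hU.frontier_eq] at hq₀
    exact hq₀.2
  refine ⟨q₀, mem_iInter.2 fun N ↦ ?_, hq₀U, ?_⟩
  · obtain ⟨k, hk⟩ := exists_nat_ge (N + K)
    refine mem_closure_of_tendsto hq_lim ?_
    filter_upwards [hf.tendsto_atTop.eventually_ge_atTop k] with i hi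
    have hki : (k : ℝ) ≤ f i := by exact_mod_cast hi
    exact largeCost_anti (by linarith) (hq_cost (f i))
  · have hpq₀ : S.Caus p q₀ := caus_of_tendsto hS (hz_lim.comp hf.tendsto_atTop) hq_lim
      (Eventually.of_forall fun i ↦ hzq (f i))
    exact hpq₀.resolve_left (by rintro rfl; exact hq₀U hpU)

theorem exists_isOpen_forall_exists_costBlowUp_notMem [T2Space M] [FirstCountableTopology M]
    (hS : ∀ p q, IsCompact (S.causalFuture p ∩ S.causalPast q)) {c : M}
    (hφ : ∃ W ∈ 𝓝 c, ∃ K : ℝ, ∀ y : Γ, (y : M) ∈ W → K ≤ φ y) :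
    ∃ U : Set M, IsOpen U ∧ c ∈ U ∧ ∀ p ∈ S.costBlowUp Γ φ, p ∈ U →
      ∃ q ∈ S.costBlowUp Γ φ, q ∉ U ∧ S.CausLt p q := by
  obtain ⟨W, hW, K, hK⟩ := hφ
  obtain ⟨R, hR, C, htarget, hRW, hC⟩ := S.exists_length_le c hW
  refine ⟨chartBall (𝓡 (n + 1)) c (R / 2), isOpen_chartBall _ c _,
    mem_of_mem_nhds (chartBall_mem_nhds _ c (half_pos hR)), fun p hp hpU ↦ ?_⟩
  exact exists_mem_costBlowUp_notMem hS (isOpen_chartBall _ c _)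
    (closure_chartBall_subset (half_lt_self hR) htarget)
    (isCompact_closure_chartBall
      ((Metric.closedBall_subset_ball (half_lt_self hR)).trans htarget))
    hC (fun y hy ↦ hK y (hRW hy)) hp hpU

theorem IsCauchySurface.costBlowUp_eq_empty [T2Space M] [SecondCountableTopology M]
    (hS : ∀ p q, IsCompact (S.causalFuture p ∩ S.causalPast q)) (hΓ : S.IsCauchySurface Γ)
    (hφ : ∀ y : Γ, (𝓝 y).IsBoundedUnder (· ≥ ·) φ) : S.costBlowUp Γ φ = ∅ := by
  refine eq_empty_of_forall_notMem fun x hx ↦ ?_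
  obtain ⟨p, hp₀, hp_blowUp, hp, hp_lim⟩ := exists_seq_rel_not_tendsto
    (fun c ↦ exists_isOpen_forall_exists_costBlowUp_notMem hS
      (exists_forall_le_of_isClosed hΓ.isClosed hφ c)) hx
  obtain ⟨q, hq₀, hq, hq_lim⟩ := S.exists_chron_seq_not_tendsto_past x
  obtain ⟨γ, hγ, -, hγp⟩ := exists_isInextendibleCausalCurve (S := S)
    (fun _ _ h ↦ h) (fun _ _ _ hk hV ↦ hV.smul hk) (hp₀.trans hq₀.symm) hp
    (fun i ↦ (hq i).causLt) hp_lim hq_lim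
  obtain ⟨t, ht, -⟩ := hΓ γ hγ
  obtain ⟨i, hi⟩ := exists_nat_gt t
  have hlt : S.CausLt (γ t) (γ i) := ⟨γ, t, i, hγ.1 t i hi, rfl, rfl⟩
  have hblowUp : γ i ∈ S.costBlowUp Γ φ := (hγp i).symm ▸ hp_blowUp i
  rcases hΓ.trichotomy (γ i) with h | ⟨y, hy, h⟩ | ⟨y, hy, h⟩
  · exact hΓ.not_causLt ht h hlt
  · exact hΓ.not_causLt ht hy (hlt.trans h.causLt)
  · obtain ⟨z, hz, y', σ, a, b, hσ, ha, hb, -⟩ := mem_closure_iff_nhds.1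
      (mem_iInter.1 hblowUp 0) _ ((S.isOpen_chronFuture y).mem_nhds h)
    exact hΓ.not_causLt hy y'.2 ((Chron.causLt hz).trans ⟨σ, a, b, hσ, ha, hb⟩)

/-- Length minus final cost is bounded above on the causal curves from `x` to `Γ`. This keeps the
suprema and infima in `dist` and `uSol` from taking junk values. -/
def BddCost (S : SpaceTime n M) (Γ : Set M) (φ : Γ → ℝ) (x : M) : Prop :=
  ∃ N : ℝ, ∀ (y : Γ) (γ : ℝ → M) (a b : ℝ), S.IsCausalCurve γ a b → γ a = x → γ b = y →
    S.length γ a b - φ y ≤ N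

theorem bddCost_of_notMem_costBlowUp {x : M} (hx : x ∉ S.costBlowUp Γ φ) : S.BddCost Γ φ x := by
  obtain ⟨N, hN⟩ : ∃ N, x ∉ closure (S.largeCost Γ φ N) := by simpa [costBlowUp] using hx
  exact ⟨N, fun y γ a b hγ ha hb ↦ not_lt.1 fun hlt ↦
    hN (subset_closure ⟨y, γ, a, b, hγ, ha, hb, hlt⟩)⟩

end SpaceTime

/-! ### The value function -/

namespace SpaceTime

variable {n : ℕ} {M : Type*} [TopologicalSpace M] [ChartedSpace (EuclideanSpace ℝ (Fin (n + 1))) M]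
  [IsManifold (𝓡 (n + 1)) ∞ M] {S : SpaceTime n M} {Γ : Set M} {φ : Γ → ℝ} {x z : M}

theorem isLUB_dist (hne : x ≠ z) (hxz : S.CausLt x z) {C : ℝ}
    (hC : ∀ γ a b, S.IsCausalCurve γ a b → γ a = x → γ b = z → S.length γ a b ≤ C) :
    IsLUB {l : ℝ | ∃ γ a b, S.IsCausalCurve γ a b ∧ γ a = x ∧ γ b = z ∧ l = S.length γ a b}
      (S.dist x z) := by
  obtain ⟨γ, a, b, hγ, ha, hb⟩ := hxz
  have hlub := isLUB_csSup (s := {l : ℝ | ∃ γ a b, S.IsCausalCurve γ a b ∧ γ a = x ∧ γ b = z ∧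
      l = S.length γ a b}) ⟨_, γ, a, b, hγ, ha, hb, rfl⟩ ⟨C, by
    rintro _ ⟨γ, a, b, hγ, ha, hb, rfl⟩
    exact hC γ a b hγ ha hb⟩
  simpa only [dist, hne, false_and, false_or] using hlub

variable [SecondCountableTopology M]

theorem IsCauchySurface.notMem_of_mem_chronPast (hΓ : S.IsCauchySurface Γ)
    (hx : x ∈ S.chronPast Γ) : x ∉ Γ := fun hxΓ ↦ by
  obtain ⟨y, hy, hxy⟩ := hx
  exact hΓ.not_causLt hxΓ hy (Chron.causLt hxy)

theorem IsCauchySurface.isGLB_uSol (hΓ : S.IsCauchySurface Γ) (hx : x ∈ S.chronPast Γ)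
    (hbdd : S.BddCost Γ φ x) :
    IsGLB {r : ℝ | ∃ (y : Γ) (γ : ℝ → M) (a b : ℝ), S.IsCausalCurve γ a b ∧ γ a = x ∧ γ b = y ∧
      r = φ y - S.length γ a b} (S.uSol Γ φ x) := by
  obtain ⟨N, hN⟩ := hbdd
  have hne (y : Γ) : x ≠ y := fun h ↦ hΓ.notMem_of_mem_chronPast hx (h ▸ y.2)
  have hdist (y : Γ) (hxy : S.Caus x y) := isLUB_dist (C := N + φ y) (hne y)
    (hxy.resolve_left (hne y)) fun γ a b hγ ha hb ↦ by linarith [hN y γ a b hγ ha hb]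
  obtain ⟨y₀, hy₀, hxy₀⟩ := hx
  have hglb := isGLB_csInf
    (s := {r : ℝ | ∃ y : Γ, (y : M) ∈ S.causalFuture x ∧ r = φ y - S.dist x y})
    ⟨_, ⟨y₀, hy₀⟩, Or.inr (Chron.causLt hxy₀), rfl⟩ ⟨-N, by
      rintro _ ⟨y, hxy, rfl⟩
      have hle : S.dist x y ≤ N + φ y := (hdist y hxy).2 (by
        rintro _ ⟨γ, a, b, hγ, ha, hb, rfl⟩
        linarith [hN y γ a b hγ ha hb])
      linarith⟩
  constructor
  · rintro _ ⟨y, γ, a, b, hγ, ha, hb, rfl⟩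
    have hxy : S.Caus x y := Or.inr ⟨γ, a, b, hγ, ha, hb⟩
    exact (hglb.1 ⟨y, hxy, rfl⟩).trans
      (sub_le_sub_left ((hdist y hxy).1 ⟨γ, a, b, hγ, ha, hb, rfl⟩) _)
  · intro r hr
    refine hglb.2 ?_
    rintro _ ⟨y, hxy, rfl⟩
    refine le_sub_comm.1 ((hdist y hxy).2 ?_)
    rintro _ ⟨γ, a, b, hγ, ha, hb, rfl⟩
    exact le_sub_comm.1 (hr ⟨y, γ, a, b, hγ, ha, hb, rfl⟩)

theorem IsCauchySurface.uSol_add_le (hΓ : S.IsCauchySurface Γ) (hx : x ∈ S.chronPast Γ)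
    (hz : z ∈ S.chronPast Γ) (hbdd : ∀ p, S.BddCost Γ φ p) {L : ℝ}
    (hL : ∀ t : ℝ, ∃ (σ : ℝ → M) (s : ℝ), S.IsCausalCurve σ s t ∧ σ s = x ∧ σ t = z ∧
      L ≤ S.length σ s t) : S.uSol Γ φ x + L ≤ S.uSol Γ φ z := by
  refine (hΓ.isGLB_uSol hz (hbdd z)).2 ?_
  rintro _ ⟨y, γ, a, b, hγ, ha, hb, rfl⟩
  obtain ⟨σ, s, hσ, hσs, hσa, hLσ⟩ := hL a
  have hsa : s < a := hσ.1
  have hab : a < b := hγ.1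
  have hconcat := IsPiecewiseC1With.concat hσ hγ (hσa.trans ha.symm)
  have hle := (hΓ.isGLB_uSol hx (hbdd x)).1 ⟨y, _, s, b, hconcat, by simp [hsa.le, hσs],
    by simp [hab, hb], rfl⟩
  have hlength := hconcat.length_add S hsa.le hab.le
  rw [S.length_congr hsa.le (γ := σ) fun t ht ↦ if_pos ht.2,
    S.length_congr hab.le (γ := γ) fun t ht ↦ ?_] at hlength
  · linarith
  · rcases ht.1.eq_or_lt with rfl | hlt
    · simp [hσa, ha]
    · exact if_neg hlt.not_ge

theorem IsCauchySurface.exists_mem_frontier_uSol_sub_lt (hΓ : S.IsCauchySurface Γ)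
    (hbdd : ∀ p, S.BddCost Γ φ p) {U : Set M} (hU : IsOpen U) (hxU : x ∈ U)
    (hUΓ : closure U ⊆ S.chronPast Γ) {ε : ℝ} (hε : 0 < ε) :
    ∃ (γ : ℝ → M) (a τ : ℝ), S.IsCausalCurve γ a τ ∧ γ a = x ∧ MapsTo γ (Icc a τ) (closure U) ∧
      γ τ ∈ frontier U ∧ S.uSol Γ φ (γ τ) - S.length γ a τ < S.uSol Γ φ x + ε := by
  obtain ⟨_, ⟨y, γ, a, b, hγ, rfl, hb, rfl⟩, -, hlt⟩ :=
    (hΓ.isGLB_uSol (hUΓ (subset_closure hxU)) (hbdd x)).exists_between (lt_add_of_pos_right _ hε)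
  have hbU : γ b ∉ closure U := fun h ↦ hΓ.notMem_of_mem_chronPast (hUΓ h) (hb ▸ y.2)
  obtain ⟨τ, hτ, hmaps, hfrontier⟩ := exists_mem_frontier_of_not_mapsTo hU hγ.2.1 hxU
    fun h ↦ hbU (subset_closure (h (right_mem_Icc.2 hγ.1.le)))
  have hτU := hmaps (right_mem_Icc.2 hτ.1.le)
  have hτb : τ < b := hτ.2.lt_of_ne (by rintro rfl; exact hbU hτU)
  refine ⟨γ, a, τ, hγ.restrict le_rfl hτ.1 hτ.2, rfl, hmaps, hfrontier, ?_⟩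
  have hle := (hΓ.isGLB_uSol (hUΓ hτU) (hbdd _)).1
    ⟨y, γ, τ, b, hγ.restrict hτ.1.le hτb le_rfl, rfl, hb, rfl⟩
  linarith [IsPiecewiseC1With.length_add S hγ hτ.1.le hτ.2]

end SpaceTime

/-! ### The gradient of the value function -/

theorem hasFDerivAt_comp_extChartAt_symm {E H F M : Type*} [NormedAddCommGroup E]
    [NormedSpace ℝ E] [TopologicalSpace H] {I : ModelWithCorners ℝ E H} [I.Boundaryless]
    [TopologicalSpace M] [ChartedSpace H M] [NormedAddCommGroup F] [NormedSpace ℝ F]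
    {f : M → F} {x : M} (hf : MDifferentiableAt I 𝓘(ℝ, F) f x) :
    HasFDerivAt (F := F) (fun e ↦ f ((extChartAt I x).symm e)) (mfderiv I 𝓘(ℝ, F) f x)
      (extChartAt I x x) := by
  have hderiv := hf.hasMFDerivAt.2
  rw [I.range_eq_univ] at hderiv
  exact hasFDerivWithinAt_univ.1 hderiv

namespace SpaceTime

variable {n : ℕ} {M : Type*} [TopologicalSpace M] [SecondCountableTopology M]
  [ChartedSpace (EuclideanSpace ℝ (Fin (n + 1))) M] [IsManifold (𝓡 (n + 1)) ∞ M]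
  {S : SpaceTime n M} {Γ : Set M} {φ : Γ → ℝ} {x : M} {V : EuclideanSpace ℝ (Fin (n + 1))}

theorem IsAdapted.uSol_add_le {ε r : ℝ} (h : S.IsAdapted x ε r) (hΓ : S.IsCauchySurface Γ)
    (hbdd : ∀ p, S.BddCost Γ φ p) (hr : chartBall (𝓡 (n + 1)) x r ⊆ S.chronPast Γ)
    (hV : V ∈ S.cone x ε) {t : ℝ} (ht : 0 < t)
    (htV : extChartAt (𝓡 (n + 1)) x x + t • V ∈ Metric.ball (extChartAt (𝓡 (n + 1)) x x) r) :
    S.uSol Γ φ x + t * √(-S.form x V V - ε * ‖V‖ ^ 2) ≤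
      S.uSol Γ φ ((extChartAt (𝓡 (n + 1)) x).symm (extChartAt (𝓡 (n + 1)) x x + t • V)) := by
  have hz := hr ((symm_mem_chartBall_iff (h.subset_target htV)).2 htV)
  refine hΓ.uSol_add_le (hr (mem_of_mem_nhds (chartBall_mem_nhds _ x h.pos))) hz hbdd fun s ↦ ?_
  -- The segment must end at time `s`, so its base point is moved back accordingly.
  set e := extChartAt (𝓡 (n + 1)) x x + (t - s) • V with he
  have hleft : e + (s - t) • V = extChartAt (𝓡 (n + 1)) x x := by rw [he]; module
  have hright : e + s • V = extChartAt (𝓡 (n + 1)) x x + t • V := by rw [he]; module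
  have hleft_mem : e + (s - t) • V ∈ Metric.ball (extChartAt (𝓡 (n + 1)) x x) r :=
    hleft ▸ Metric.mem_ball_self h.pos
  have hlength := h.le_length_chartLine (sub_lt_self s ht) hleft_mem (hright ▸ htV)
  rw [sub_sub_cancel] at hlength
  refine ⟨_, s - t, (h.isTimelikeCurve_chartLine (sub_lt_self s ht) hleft_mem (hright ▸ htV)
    hV).isCausalCurve, ?_, ?_, hlength⟩
  · rw [chartLine, hleft, extChartAt_to_inv]
  · rw [chartLine, hright]

variable {l : EuclideanSpace ℝ (Fin (n + 1)) →L[ℝ] ℝ}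

theorem IsCauchySurface.sqrt_le_of_hasFDerivAt_uSol (hΓ : S.IsCauchySurface Γ)
    (hbdd : ∀ p, S.BddCost Γ φ p) (hx : x ∈ S.chronPast Γ)
    (hl : HasFDerivAt (fun e ↦ S.uSol Γ φ ((extChartAt (𝓡 (n + 1)) x).symm e)) l
      (extChartAt (𝓡 (n + 1)) x x))
    (hV : S.form x V V < 0) (hXV : S.form x (S.vec x) V < 0) : √(-S.form x V V) ≤ l V := by
  have hslope := (hl.hasLineDerivAt V).tendsto_slope_zero_right
  have hle : ∀ᶠ ε in 𝓝[>] (0 : ℝ), √(-S.form x V V - ε * ‖V‖ ^ 2) ≤ l V := by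
    filter_upwards [eventually_mem_cone hV hXV, self_mem_nhdsWithin] with ε hVε hε
    obtain ⟨r, hr, hrΓ⟩ := S.exists_isAdapted x hε ((S.isOpen_chronPast Γ).mem_nhds hx)
    have hball : ∀ᶠ t in 𝓝[>] (0 : ℝ), extChartAt (𝓡 (n + 1)) x x + t • V ∈
        Metric.ball (extChartAt (𝓡 (n + 1)) x x) r := by
      have hcont : ContinuousAt (fun t : ℝ ↦ extChartAt (𝓡 (n + 1)) x x + t • V) 0 := by fun_prop
      exact nhdsWithin_le_nhds
        (hcont.preimage_mem_nhds (by simpa using Metric.ball_mem_nhds _ hr.pos))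
    refine ge_of_tendsto hslope ?_
    filter_upwards [hball, self_mem_nhdsWithin] with t htV ht
    have hadd := hr.uSol_add_le hΓ hbdd hrΓ hVε ht htV
    rw [smul_eq_mul, extChartAt_to_inv, le_inv_mul_iff₀ ht]
    linarith
  have hlim : Tendsto (fun ε : ℝ ↦ √(-S.form x V V - ε * ‖V‖ ^ 2)) (𝓝[>] 0)
      (𝓝 (√(-S.form x V V))) := by
    refine tendsto_nhdsWithin_of_tendsto_nhds ?_
    exact Continuous.tendsto' (by fun_prop) _ _ (by simp)
  exact le_of_tendsto hlim hle

theorem IsCauchySurface.neg_one_le_of_hasFDerivAt_uSol [T2Space M] (hΓ : S.IsCauchySurface Γ)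
    (hbdd : ∀ p, S.BddCost Γ φ p) (hx : x ∈ S.chronPast Γ)
    (hl : HasFDerivAt (fun e ↦ S.uSol Γ φ ((extChartAt (𝓡 (n + 1)) x).symm e)) l
      (extChartAt (𝓡 (n + 1)) x x))
    {G : EuclideanSpace ℝ (Fin (n + 1))} (hGl : ∀ v, S.form x G v = l v)
    (hXG : 0 < S.form x (S.vec x) G) : -1 ≤ S.form x G G := by
  by_contra! hG
  obtain ⟨δ, hδ, R, hR, hRΓ, hlength⟩ :=
    S.exists_length_add_le hG hXG ((S.isOpen_chronPast Γ).mem_nhds hx)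
  obtain ⟨r', hr', hlin⟩ := Metric.eventually_nhds_iff_ball.1
    ((hasFDerivAt_iff_isLittleO.1 hl).def (half_pos hδ))
  obtain ⟨r, hr, hr_lt⟩ := exists_between (lt_min hR.pos hr')
  have hmin : Metric.ball (extChartAt (𝓡 (n + 1)) x x) (min R r') ⊆
      (extChartAt (𝓡 (n + 1)) x).target :=
    (Metric.ball_subset_ball (min_le_left _ _)).trans hR.subset_target
  have hclosure := closure_chartBall_subset hr_lt hmin
  have hclosureR := hclosure.trans (chartBall_subset_chartBall _ x (min_le_left R r'))
  obtain ⟨γ, a, τ, hγ, ha, hmaps, hfrontier, hlt⟩ := hΓ.exists_mem_frontier_uSol_sub_lt hbdd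
    (isOpen_chartBall _ x r) (mem_of_mem_nhds (chartBall_mem_nhds _ x hr))
    (hclosureR.trans hRΓ) (mul_pos (half_pos hδ) hr)
  obtain ⟨hτ_source, hτ_ball⟩ := hclosure (hmaps (right_mem_Icc.2 hγ.1.le))
  have hτ_le : r ≤ ‖extChartAt (𝓡 (n + 1)) x (γ τ) - extChartAt (𝓡 (n + 1)) x x‖ := by
    rw [(isOpen_chartBall _ x r).frontier_eq] at hfrontier
    rw [← dist_eq_norm]
    exact not_lt.1 fun h ↦ hfrontier.2 ⟨hτ_source, h⟩
  have hlower := (abs_le.1 (hlin _ (Metric.ball_subset_ball (min_le_right _ _) hτ_ball))).1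
  have hupper := hlength γ a τ hγ (hmaps.mono_right hclosureR)
  rw [ha, hGl] at hupper
  rw [(extChartAt (𝓡 (n + 1)) x).left_inv hτ_source, extChartAt_to_inv] at hlower
  linarith [mul_le_mul_of_nonneg_left hτ_le (half_pos hδ).le]

end SpaceTime

/-! ### Local boundedness of locally Lipschitz functions -/

theorem eventually_riemDist_lt_one {n : ℕ} {M : Type*} [TopologicalSpace M]
    [ChartedSpace (EuclideanSpace ℝ (Fin (n + 1))) M] [IsManifold (𝓡 (n + 1)) ∞ M]
    (h : ContMDiffRiemannianMetric (𝓡 (n + 1)) ∞ (EuclideanSpace ℝ (Fin (n + 1)))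
      (fun x : M ↦ TangentSpace (𝓡 (n + 1)) x)) (y : M) :
    ∀ᶠ z in 𝓝 y, riemDist h y z < 1 := by
  let _ : RiemannianBundle (fun x : M ↦ TangentSpace (𝓡 (n + 1)) x) := ⟨h.toRiemannianMetric⟩
  have : IsContinuousRiemannianBundle (EuclideanSpace ℝ (Fin (n + 1)))
      (fun x : M ↦ TangentSpace (𝓡 (n + 1)) x) :=
    ⟨⟨h.inner, h.contMDiff.continuous, fun _ _ _ ↦ rfl⟩⟩
  exact eventually_riemannianEDist_lt (𝓡 (n + 1)) y one_pos

theorem IsLocLipschitz.isBoundedUnder_ge {n : ℕ} {M : Type*} [TopologicalSpace M]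
    [ChartedSpace (EuclideanSpace ℝ (Fin (n + 1))) M] [IsManifold (𝓡 (n + 1)) ∞ M]
    {h : ContMDiffRiemannianMetric (𝓡 (n + 1)) ∞ (EuclideanSpace ℝ (Fin (n + 1)))
      (fun x : M ↦ TangentSpace (𝓡 (n + 1)) x)} {Γ : Set M} {φ : Γ → ℝ}
    (hφ : IsLocLipschitz h Γ φ) (y : Γ) : (𝓝 y).IsBoundedUnder (· ≥ ·) φ := by
  obtain ⟨U, hU, K, hK⟩ := hφ y
  refine ⟨φ y - K, eventually_map.2 ?_⟩
  filter_upwards [continuousAt_subtype_val.eventually hU,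
    continuousAt_subtype_val.eventually (eventually_riemDist_lt_one h y)] with z hzU hz
  have hle : ENNReal.ofReal |φ y - φ z| ≤ K :=
    (hK y z (mem_of_mem_nhds hU) hzU).trans (mul_le_of_le_one_right' hz.le)
  rw [← ENNReal.ofReal_coe_nnreal] at hle
  exact sub_le_comm.1 ((le_abs_self _).trans ((ENNReal.ofReal_le_ofReal_iff K.2).1 hle))

theorem mainTheorem6_general {n : ℕ} {M : Type*} [TopologicalSpace M] [T2Space M]
    [SecondCountableTopology M]
    [ChartedSpace (EuclideanSpace ℝ (Fin (n + 1))) M] [IsManifold (𝓡 (n + 1)) ∞ M]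
    (S : SpaceTime n M) (hS : ∀ p q, IsCompact (S.causalFuture p ∩ S.causalPast q))
    (Γ : Set M) (hΓ : S.IsCauchySurface Γ)
    (φ : Γ → ℝ) (hφ : ∀ y : Γ, (𝓝 y).IsBoundedUnder (· ≥ ·) φ)
    (x : M) (hx : x ∈ S.chronPast Γ)
    (hdiff : MDifferentiableAt (𝓡 (n + 1)) 𝓘(ℝ, ℝ) (S.uSol Γ φ) x) :
    S.IsTimelike (S.grad (S.uSol Γ φ) x) ∧
      S.IsPastDirected (S.grad (S.uSol Γ φ) x) ∧
      S.val x (S.grad (S.uSol Γ φ) x) (S.grad (S.uSol Γ φ) x) = -1 := by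
  have hbdd (p : M) : S.BddCost Γ φ p :=
    SpaceTime.bddCost_of_notMem_costBlowUp (by simp [hΓ.costBlowUp_eq_empty hS hφ])
  have hderiv := hasFDerivAt_comp_extChartAt_symm hdiff
  have hgrad (V : EuclideanSpace ℝ (Fin (n + 1))) :
      S.form x (S.grad (S.uSol Γ φ) x) V = mfderiv (𝓡 (n + 1)) 𝓘(ℝ, ℝ) (S.uSol Γ φ) x V :=
    S.val_grad _ x V
  have hsqrt (V : EuclideanSpace ℝ (Fin (n + 1))) (hV : S.form x V V < 0)
      (hXV : S.form x (S.vec x) V < 0) : √(-S.form x V V) ≤ S.form x (S.grad (S.uSol Γ φ) x) V :=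
    (hΓ.sqrt_le_of_hasFDerivAt_uSol hbdd hx hderiv hV hXV).trans_eq (hgrad V).symm
  have hform := (S.isLorentzForm_form x).toIsSymm
  have hX := S.form_vec_vec_neg x
  have hXgrad : 0 < S.form x (S.vec x) (S.grad (S.uSol Γ φ) x) :=
    (Real.sqrt_pos.2 (neg_pos.2 hX)).trans_le ((hsqrt _ hX hX).trans_eq (hform.eq _ _))
  have heq : S.val x (S.grad (S.uSol Γ φ) x) (S.grad (S.uSol Γ φ) x) = -1 :=
    le_antisymm (apply_self_le_neg_one_of_forall_sqrt_le hform hX hsqrt)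
      (hΓ.neg_one_le_of_hasFDerivAt_uSol hbdd hx hderiv hgrad hXgrad)
  have hneg : S.IsTimelike (S.grad (S.uSol Γ φ) x) := heq.trans_lt neg_one_lt_zero
  refine ⟨hneg, ⟨⟨fun h₀ ↦ ?_, hneg.le⟩, hXgrad⟩, heq⟩
  simp [h₀] at heq

theorem mainTheorem6 {n : ℕ} {M : Type*} [TopologicalSpace M] [T2Space M]
    [SecondCountableTopology M] [ConnectedSpace M]
    [ChartedSpace (EuclideanSpace ℝ (Fin (n + 1))) M] [IsManifold (𝓡 (n + 1)) ∞ M]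
    (S : SpaceTime n M) (hS : S.IsGloballyHyperbolic)
    (Γ : Set M) (hΓ : S.IsCauchySurface Γ)
    (h : ContMDiffRiemannianMetric (𝓡 (n + 1)) ∞ (EuclideanSpace ℝ (Fin (n + 1)))
      (fun x : M ↦ TangentSpace (𝓡 (n + 1)) x))
    (φ : Γ → ℝ) (hφ : IsLocLipschitz h Γ φ)
    (x : M) (hx : x ∈ S.chronPast Γ)
    (hdiff : MDifferentiableAt (𝓡 (n + 1)) 𝓘(ℝ, ℝ) (S.uSol Γ φ) x) :
    S.IsTimelike (S.grad (S.uSol Γ φ) x) ∧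
      S.IsPastDirected (S.grad (S.uSol Γ φ) x) ∧
      S.val x (S.grad (S.uSol Γ φ) x) (S.grad (S.uSol Γ φ) x) = -1 :=
  mainTheorem6_general S hS.2 Γ hΓ φ hφ.isBoundedUnder_ge x hx hdiff
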